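/- Let $a\ge 2$ be an integer and let $\alpha\in\mathbb{C}\setminus\mathbb{R}$ be a root of $x^3-ax^2+x-1$. Define $G_0=1$, $G_1=a$, $G_2=a^2-1$ and $G_{n+3}=aG_{n+2}-G_{n+1}+G_n$ for $n\ge 0$. A finite sequence $(\varepsilon_i)_{0\le i\le N}$ of nonnegative integers is a greedy $G$-expansion if $\sum_{i=0}^{j}\varepsilon_iG_i<G_{j+1}$ for all $0\le j\le N$. Let $$\mathcal{G}_a=\Big\{\sum_{i=2}^{\infty}a_i\alpha^i \;:\; (a_{i+2})_{0\le i\le N}\text{ is a greedy }G\text{-expansion for every }N\ge 0\Big\}\subset\mathbb{C}.$$ The translates $\mathcal{G}_a+u$, $u\in\mathbb{Z}+\mathbb{Z}\alpha$, form a periodic tiling of the plane: they cover $\mathbb{C}$, and if $u,v\in\mathbb{Z}+\mathbb{Z}\alpha$ and $\mathrm{int}(\mathcal{G}_a+u)\cap(\mathcal{G}_a+v)\ne\emptyset$, then $u=v$. Moreover, with $B=\{\pm1,\pm\alpha,\pm(\alpha-1)\}$, $$\partial\mathcal{G}_a=\bigcup_{u\in B}\mathcal{G}_a\cap(\mathcal{G}_a+u).$$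 The set of neighbors of $\mathcal{G}_a$ in this tiling, i.e. the set of $u\in(\mathbb{Z}+\mathbb{Z}\alpha)\setminus\{0\}$ with $\mathcal{G}_a\cap(\mathcal{G}_a+u)\ne\emptyset$, is exactly $B$ and has exactly $6$ elements. -/

import Mathlib

open scoped BigOperators

namespace GRauzy

/-- The sequence `1, a, a² - 1, …` with `Gₙ₊₃ = a Gₙ₊₂ - Gₙ₊₁ + Gₙ`. -/
def gSeq (a : ℕ) : ℕ → ℤ
  | 0 => 1
  | 1 => a
  | 2 => (a : ℤ) ^ 2 - 1
  | n + 3 => a * gSeq a (n + 2) - gSeq a (n + 1) + gSeq a n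

/-- The word `ε₀ ε₁ … ε_N` (least significant digit first) is a greedy `G`-expansion, that is, the
digit string which the greedy algorithm in base `(Gₙ)` produces, possibly padded with zeros on the
most significant side: the part of the sum up to each position is smaller than the next element of
the base. -/
def IsGreedy (a : ℕ) (ε : ℕ → ℕ) (N : ℕ) : Prop :=
  ∀ j ≤ N, ∑ i ∈ Finset.range (j + 1), (ε i : ℤ) * gSeq a i < gSeq a (j + 1)

/-- The `G`-Rauzy fractal: all sums `∑_{i ≥ 2} aᵢ αⁱ` such that every word `a₂ a₃ … a_N` is a greedy
`G`-expansion. Here `ε i` is the digit `a_{i+2}`. -/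
def fractal (a : ℕ) (α : ℂ) : Set ℂ :=
  {z | ∃ ε : ℕ → ℕ, (∀ N, IsGreedy a ε N) ∧ HasSum (fun i : ℕ => (ε i : ℂ) * α ^ (i + 2)) z}

/-- The translate `𝒢_a + u`. -/
def tile (a : ℕ) (α u : ℂ) : Set ℂ := (fun z => z + u) '' fractal a α

/-- The group of periods `ℤ + ℤα`. -/
def lattice (α : ℂ) : Set ℂ := {u | ∃ p q : ℤ, u = (p : ℂ) + (q : ℂ) * α}

/-- The nonzero periods `u` for which the tile `𝒢_a + u` meets `𝒢_a`. -/
def neighbors (a : ℕ) (α : ℂ) : Set ℂ :=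
  {u | u ∈ lattice α ∧ u ≠ 0 ∧ (fractal a α ∩ tile a α u).Nonempty}

/-- The translations `±1, ±α, ±(α - 1)`. -/
def sixTranslations (α : ℂ) : Set ℂ := {1, -1, α, -α, α - 1, -(α - 1)}

end GRauzy

/-! If two points of the fractal with digits `ε`, `ε'` differ by p + qα, removing the digits ε − ε'
one at a time from p + qα and reducing by the cubic leaves integer carries `W`, with `W 1 = p` and
`W 2 = p + q`. `IsCarry.sum_add` gives an invariant of this process for each solution of the
recurrence, and three solutions are used. Powers of α, where |α| < 1, bound `W` (`IsCarry.bounded`).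
Powers of the real root 1/g, with g = |α|², turn greediness into an inequality between three
consecutive carries, and a descent gives |W k| ≤ 1 for large k (`eventually_carry_le_one`). The
integer base brings this back to all k (`IsCarry.forall_abs_le_one`). The first three carries then
leave only 0 and the six translations (`tile_meets`); explicit eventually periodic carries realize
all six.

If one string is finite, all carries vanish (`carry_eq_zero_of_finite`), so a finite expansion lies
in a single tile. Such points are dense in each tile, hence no interior meets another tile. For the
covering, α^k is an integer multiple of α² modulo the lattice, so greedy expansions of integers make
the union of the tiles dense; it is also closed. The boundary formula follows from covering,
neighbors and disjointness. -/

namespace GRauzy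

/-! ### The integer base and greedy digit strings. -/

/-- The linear recurrence `xₙ₊₃ = a xₙ₊₂ - xₙ₊₁ + xₙ` in a commutative ring. -/
def IsRec {R : Type*} [CommRing R] (a : ℕ) (f : ℕ → R) : Prop :=
  ∀ n, f (n + 3) = a * f (n + 2) - f (n + 1) + f n

/-- The impulse solution `0, 0, 1, a, a² - 1, …` of the recurrence: `gSeq` shifted by two. -/
def impulse (a : ℕ) : ℕ → ℤ
  | 0 => 0
  | 1 => 0
  | 2 => 1
  | n + 3 => a * impulse a (n + 2) - impulse a (n + 1) + impulse a n

theorem impulse_isRec (a : ℕ) : IsRec a (impulse a) := fun n => by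
  simp [impulse]

theorem gSeq_eq_impulse (a : ℕ) : ∀ n, gSeq a n = impulse a (n + 2)
  | 0 => by simp [gSeq, impulse]
  | 1 => by simp [gSeq, impulse]
  | 2 => by simp [gSeq, impulse]; ring
  | n + 3 => by
    rw [gSeq, gSeq_eq_impulse a n, gSeq_eq_impulse a (n + 1), gSeq_eq_impulse a (n + 2),
      impulse_isRec a (n + 2)]

theorem isRec_pow {R : Type*} [CommRing R] (a : ℕ) {x : R}
    (hx : x ^ 3 - (a : R) * x ^ 2 + x - 1 = 0) : IsRec a (fun n => x ^ n) := fun n => by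
  linear_combination x ^ n * hx

/-- The characteristic polynomial times x + 1. The coefficients become nonnegative, and (a−1)(a−1)01
appears as the critical digit word. -/
theorem IsRec.four {R : Type*} [CommRing R] {a : ℕ} {f : ℕ → R} (hf : IsRec a f) (n : ℕ) :
    f (n + 4) = (a - 1) * f (n + 3) + (a - 1) * f (n + 2) + f n := by
  linear_combination hf (n + 1) + hf n

section Impulse

variable {a : ℕ}

theorem impulse_growth (ha : 2 ≤ a) (n : ℕ) :
    0 ≤ impulse a n ∧ impulse a n ≤ impulse a (n + 1) ∧
      impulse a (n + 1) + 1 ≤ impulse a (n + 2) := by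
  have ha' : (2 : ℤ) ≤ a := by exact_mod_cast ha
  induction n with
  | zero => simp [impulse]
  | succ n ih =>
    obtain ⟨h0, h1, h2⟩ := ih
    have := impulse_isRec a n
    refine ⟨by linarith, by linarith, ?_⟩
    rw [show n + 1 + 2 = n + 3 by ring, show n + 1 + 1 = n + 2 by ring, this]
    nlinarith

theorem impulse_nonneg (ha : 2 ≤ a) (n : ℕ) : 0 ≤ impulse a n := (impulse_growth ha n).1

theorem impulse_pos (ha : 2 ≤ a) (n : ℕ) : 0 < impulse a (n + 2) := by
  have := impulse_growth ha n
  linarith [this.1, this.2.1, this.2.2]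

theorem impulse_mono (ha : 2 ≤ a) : Monotone (impulse a) :=
  monotone_nat_of_le_succ fun n => (impulse_growth ha n).2.1

theorem le_impulse (ha : 2 ≤ a) (n : ℕ) : (n : ℤ) ≤ impulse a (n + 1) := by
  induction n with
  | zero => simp [impulse]
  | succ n ih =>
    have := (impulse_growth ha n).2.2
    push_cast
    linarith

theorem impulse_convex (ha : 2 ≤ a) (n : ℕ) :
    2 * impulse a (n + 1) ≤ impulse a (n + 2) + impulse a n := by
  have ha' : (2 : ℤ) ≤ a := by exact_mod_cast ha
  cases n with
  | zero => simp [impulse]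
  | succ n =>
    have h := impulse_isRec a n
    have h0 := impulse_nonneg ha n
    have h2 := impulse_nonneg ha (n + 2)
    rw [show n + 1 + 2 = n + 3 by ring, show n + 1 + 1 = n + 2 by ring, h]
    nlinarith

theorem impulse_succ_le (ha : 2 ≤ a) (n : ℕ) : impulse a (n + 3) ≤ a * impulse a (n + 2) := by
  have := impulse_isRec a n
  linarith [(impulse_growth ha n).2.1]

end Impulse

/-- An infinite digit string all of whose prefixes are greedy. -/
def Admissible (a : ℕ) (ε : ℕ → ℕ) : Prop := ∀ N, IsGreedy a ε N

theorem admissible_iff (a : ℕ) (ε : ℕ → ℕ) : Admissible a ε ↔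
    ∀ k, ∑ i ∈ Finset.range k, (ε i : ℤ) * impulse a (i + 2) < impulse a (k + 2) ∨ k = 0 := by
  constructor
  · intro h k
    cases k with
    | zero => simp
    | succ k =>
      left
      simpa only [gSeq_eq_impulse] using h k k le_rfl
  · intro h N j _
    simpa [gSeq_eq_impulse] using h (j + 1)

variable {a : ℕ} {ε : ℕ → ℕ}

theorem Admissible.sum_lt (h : Admissible a ε) (k : ℕ) :
    ∑ i ∈ Finset.range k, (ε i : ℤ) * impulse a (i + 2) < impulse a (k + 2) := by
  rcases (admissible_iff a ε).1 h k with h | rfl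
  · exact h
  · simp [impulse]

theorem Admissible.of_sum_lt
    (h : ∀ k, ∑ i ∈ Finset.range k, (ε i : ℤ) * impulse a (i + 2) < impulse a (k + 2)) :
    Admissible a ε := (admissible_iff a ε).2 fun k => Or.inl (h k)

theorem sum_impulse_nonneg (ha : 2 ≤ a) (ε : ℕ → ℕ) (k : ℕ) :
    0 ≤ ∑ i ∈ Finset.range k, (ε i : ℤ) * impulse a (i + 2) :=
  Finset.sum_nonneg fun i _ => mul_nonneg (by positivity) (impulse_nonneg ha _)

theorem Admissible.digit_lt (ha : 2 ≤ a) (h : Admissible a ε) (k : ℕ) : ε k < a := by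
  have h1 := h.sum_lt (k + 1)
  rw [Finset.sum_range_succ] at h1
  have h2 := sum_impulse_nonneg ha ε k
  have h3 := impulse_succ_le ha k
  have h4 := impulse_pos ha k
  have : (ε k : ℤ) < a := by
    by_contra hc
    push Not at hc
    have := mul_le_mul_of_nonneg_right hc h4.le
    rw [show k + 1 + 2 = k + 3 by ring] at h1
    linarith
  exact_mod_cast this

theorem Admissible.sum_lt_of_max (h : Admissible a ε) {k : ℕ}
    (h0 : ε k + 1 = a) (h1 : ε (k + 1) + 1 = a) :
    ∑ i ∈ Finset.range k, (ε i : ℤ) * impulse a (i + 2) < impulse a k := by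
  have hs := h.sum_lt (k + 2)
  rw [Finset.sum_range_succ, Finset.sum_range_succ] at hs
  have h4 := (impulse_isRec a).four k
  have e0 : (ε k : ℤ) = a - 1 := by rw [← h0]; push_cast; ring
  have e1 : (ε (k + 1) : ℤ) = a - 1 := by rw [← h1]; push_cast; ring
  rw [e0, e1, show k + 2 + 2 = k + 4 by ring, show k + 1 + 2 = k + 3 by ring, h4] at hs
  linarith

/-- Two adjacent digits a − 1 leave less than `impulse a k` for the lower digits, and the two digits
just below have weights at least that large. For k ≤ 1 no room is left, as `impulse` vanishes there.
-/
theorem Admissible.zero_of_max (ha : 2 ≤ a) (h : Admissible a ε) {k : ℕ}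
    (h0 : ε k + 1 = a) (h1 : ε (k + 1) + 1 = a) :
    ∃ j, k = j + 2 ∧ ε j = 0 ∧ ε (j + 1) = 0 := by
  have hs := h.sum_lt_of_max h0 h1
  match k, hs with
  | 0, hs => simp [impulse] at hs
  | 1, hs => simp [impulse] at hs; omega
  | j + 2, hs =>
    refine ⟨j, rfl, ?_⟩
    rw [Finset.sum_range_succ, Finset.sum_range_succ] at hs
    have hn := sum_impulse_nonneg ha ε j
    have hp := impulse_pos ha j
    have hq : impulse a (j + 2) ≤ impulse a (j + 1 + 2) := impulse_mono ha (by omega)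
    have key : ((ε j : ℤ) + ε (j + 1)) * impulse a (j + 2) < 1 * impulse a (j + 2) := by
      nlinarith [mul_le_mul_of_nonneg_left hq (Int.natCast_nonneg (ε (j + 1)))]
    have := lt_of_mul_lt_mul_right key hp.le
    omega

/-- Greediness passes from the integer base to the real root. Only a top pair a − 1, a − 1 is
critical; the two zeros beneath it and `IsRec.four` reduce it to a shorter prefix. -/
theorem Admissible.sum_pow_lt (ha : 2 ≤ a) (h : Admissible a ε) {β : ℝ}
    (hβ : β ^ 3 - (a : ℝ) * β ^ 2 + β - 1 = 0) (hβa : (a : ℝ) - 1 < β) (k : ℕ) :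
    ∑ i ∈ Finset.range k, (ε i : ℝ) * β ^ i < β ^ k := by
  have ha' : (2 : ℝ) ≤ a := by exact_mod_cast ha
  have hpos : ∀ n, 0 < β ^ n := fun n => pow_pos (by linarith) n
  have hrec := isRec_pow a hβ
  induction k using Nat.strong_induction_on with
  | _ k ih =>
  match k, ih with
  | 0, _ => simp
  | k + 1, ih =>
    rw [Finset.sum_range_succ]
    have hk := h.digit_lt ha k
    have hp := hpos k
    have i0 := ih k (by omega)
    by_cases hmax : ε k + 1 = a
    · have e0 : (ε k : ℝ) = a - 1 := by rw [← hmax]; push_cast; ring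
      match k, hmax, e0, ih, i0, hp with
      | 0, _, e0, _, _, _ => simpa [e0] using hβa
      | k + 1, hmax, e0, ih, i0, hp =>
        rw [Finset.sum_range_succ]
        have hk1 := h.digit_lt ha k
        have i1 := ih k (by omega)
        have hq := hpos k
        by_cases hmax1 : ε k + 1 = a
        · obtain ⟨j, rfl, hj0, hj1⟩ := h.zero_of_max ha hmax1 hmax
          have i2 := ih j (by omega)
          have e1 : (ε (j + 2) : ℝ) = a - 1 := by rw [← hmax1]; push_cast; ring
          have : β ^ (j + 4) = (a - 1) * β ^ (j + 3) + (a - 1) * β ^ (j + 2) + β ^ j :=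
            hrec.four j
          rw [Finset.sum_range_succ, Finset.sum_range_succ, hj0, hj1, e1, e0,
            show j + 2 + 1 + 1 = j + 4 by ring, show j + 2 + 1 = j + 3 by ring, this]
          push_cast
          linarith
        · have hle : (ε k : ℝ) ≤ a - 2 := by
            have : ε k + 2 ≤ a := by omega
            have : ((ε k + 2 : ℕ) : ℝ) ≤ a := by exact_mod_cast this
            push_cast at this
            linarith
          have h4 : (a - 1) * (β ^ (k + 1) + β ^ k) ≤ β ^ (k + 2) := by
            have : (a - 1) * (β + 1) ≤ β ^ 2 := by
              have h5 : β ^ 2 * (β ^ 2 - (a - 1) * (β + 1)) = 1 := by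
                linear_combination (β + 1) * hβ
              have h6 := hpos 2
              by_contra hc
              push Not at hc
              nlinarith
            calc (a - 1) * (β ^ (k + 1) + β ^ k) = ((a - 1) * (β + 1)) * β ^ k := by ring
              _ ≤ β ^ 2 * β ^ k := mul_le_mul_of_nonneg_right this hq.le
              _ = _ := by ring
          rw [e0, show k + 1 + 1 = k + 2 by ring]
          nlinarith [mul_le_mul_of_nonneg_right hle hq.le]
    · have hle : (ε k : ℝ) ≤ a - 2 := by
        have : ε k + 2 ≤ a := by omega
        have : ((ε k + 2 : ℕ) : ℝ) ≤ a := by exact_mod_cast this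
        push_cast at this
        linarith
      have h1 := mul_le_mul_of_nonneg_right hle hp.le
      have h2 := mul_lt_mul_of_pos_right hβa hp
      rw [pow_succ]
      linarith

/-- Digits below `a` without two adjacent maximal digits form an admissible string. -/
theorem admissible_of_no_adjacent_max (ha : 2 ≤ a) (h : ∀ k, ε k < a)
    (h2 : ∀ k, ε k + 1 = a → ε (k + 1) + 1 ≠ a) : Admissible a ε := by
  refine Admissible.of_sum_lt fun k => ?_
  have ha' : (2 : ℤ) ≤ a := by exact_mod_cast ha
  induction k using Nat.strong_induction_on with
  | _ k ih =>
  match k, ih with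
  | 0, _ => simp [impulse]
  | k + 1, ih =>
    rw [Finset.sum_range_succ]
    have hk := h k
    have hp := impulse_pos ha k
    have i0 := ih k (by omega)
    by_cases hmax : ε k + 1 = a
    · have e0 : (ε k : ℤ) = a - 1 := by rw [← hmax]; push_cast; ring
      match k, hmax, e0, ih, i0, hp with
      | 0, _, e0, _, _, _ => simp [e0, impulse]
      | k + 1, hmax, e0, ih, i0, hp =>
        rw [Finset.sum_range_succ]
        have hk1 : (ε k : ℤ) ≤ a - 2 := by
          have := h k
          have : ε k + 1 ≠ a := fun hc => h2 k hc hmax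
          omega
        have i1 := ih k (by omega)
        have hq := impulse_pos ha k
        have h4 := (impulse_isRec a).four k
        have hn := impulse_nonneg ha k
        rw [e0, show k + 1 + 1 + 2 = k + 4 by ring, h4, show k + 1 + 2 = k + 3 by ring]
        nlinarith [mul_le_mul_of_nonneg_right hk1 hq.le]
    · have hle : (ε k : ℤ) ≤ a - 2 := by omega
      have h3 := impulse_isRec a k
      have hg := impulse_growth ha k
      rw [show k + 1 + 2 = k + 3 by ring, h3]
      nlinarith [mul_le_mul_of_nonneg_right hle hp.le]

end GRauzy

/-! ### Carry sequences and their boundedness. -/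

namespace GRauzy
open Filter Topology

/-- `W` is the integer sequence of carries that appear when a period is expanded with the
(signed) digits `d`. -/
def IsCarry (a : ℕ) (d W : ℕ → ℤ) : Prop :=
  W 0 = 0 ∧ ∀ n, W (n + 3) = W n - a * W (n + 1) + W (n + 2) - d n

/-- The carry sequence of the period `p + qα` with respect to the digits `d`. -/
def carry (a : ℕ) (p q : ℤ) (d : ℕ → ℤ) : ℕ → ℤ
  | 0 => 0
  | 1 => p
  | 2 => p + q
  | n + 3 => carry a p q d n - a * carry a p q d (n + 1) + carry a p q d (n + 2) - d n

theorem isCarry_carry (a : ℕ) (p q : ℤ) (d : ℕ → ℤ) : IsCarry a d (carry a p q d) :=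
  ⟨by simp [carry], fun n => by simp [carry]⟩

/-- The bracket is what remains of the period after k digits. For `carry` the right side is p · f 0
+ q · f 1. -/
theorem IsCarry.sum_add {R : Type*} [CommRing R] {a : ℕ} {d W : ℕ → ℤ} (hW : IsCarry a d W)
    {f : ℕ → R} (hf : IsRec a f) (k : ℕ) :
    ∑ i ∈ Finset.range k, (d i : R) * f (i + 2) + (W k * f (k + 2) +
      W (k + 1) * (f k - f (k + 1)) + W (k + 2) * f (k + 1)) =
      W 1 * (f 0 - f 1) + W 2 * f 1 := by
  induction k with
  | zero => simp [hW.1]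
  | succ k ih =>
    rw [← ih, Finset.sum_range_succ]
    have h1 : (W (k + 3) : R) = W k - a * W (k + 1) + W (k + 2) - d k := by
      rw [hW.2 k]; push_cast; ring
    have h2 := hf k
    rw [show k + 1 + 2 = k + 3 by ring, show k + 1 + 1 = k + 2 by ring, h1, h2]
    ring

theorem IsCarry.sum_impulse {a : ℕ} {d W : ℕ → ℤ} (hW : IsCarry a d W) (k : ℕ) :
    ∑ i ∈ Finset.range k, d i * impulse a (i + 2) + (W k * impulse a (k + 2) +
      W (k + 1) * (impulse a k - impulse a (k + 1)) + W (k + 2) * impulse a (k + 1)) = 0 := by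
  have := hW.sum_add (impulse_isRec a) k
  simpa [impulse] using this

section Root

variable {a : ℕ} {α : ℂ}

theorem root_relations (hroot : α ^ 3 - (a : ℂ) * α ^ 2 + α - 1 = 0) (hnonreal : α.im ≠ 0) :
    3 * α.re ^ 2 - α.im ^ 2 - 2 * a * α.re + 1 = 0 ∧
      Complex.normSq α * (a - 2 * α.re) = 1 := by
  have h1 := congrArg Complex.re hroot
  have h2 := congrArg Complex.im hroot
  simp [pow_succ, Complex.mul_re, Complex.mul_im] at h1 h2
  rw [Complex.normSq_apply]
  have h3 : 3 * α.re ^ 2 - α.im ^ 2 - 2 * a * α.re + 1 = 0 := by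
    apply mul_left_cancel₀ hnonreal
    linear_combination h2
  exact ⟨h3, by linear_combination h1 - α.re * h3⟩

/-- The three roots have product 1, so |α|² is the inverse of the real root and solves the
reciprocal cubic. -/
theorem normSq_root (hroot : α ^ 3 - (a : ℂ) * α ^ 2 + α - 1 = 0) (hnonreal : α.im ≠ 0) :
    Complex.normSq α ^ 3 - Complex.normSq α ^ 2 + a * Complex.normSq α - 1 = 0 := by
  obtain ⟨h1, h2⟩ := root_relations hroot hnonreal
  have hn : Complex.normSq α = α.re ^ 2 + α.im ^ 2 := by rw [Complex.normSq_apply]; ring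
  set g := Complex.normSq α
  have h3 : 2 * α.re * (2 * α.re - a) + 1 = g := by rw [hn]; linear_combination h1
  have h4 : 2 * α.re = g - g ^ 2 := by
    linear_combination -g * h3 - 2 * α.re * h2
  linear_combination h2 + g * h4

theorem normSq_lt_one (ha : 2 ≤ a) {g : ℝ} (hg : g ^ 3 - g ^ 2 + a * g - 1 = 0) : g < 1 := by
  have ha' : (2 : ℝ) ≤ a := by exact_mod_cast ha
  by_contra hc
  push Not at hc
  nlinarith [mul_nonneg (sq_nonneg g) (sub_nonneg.2 hc)]

theorem norm_lt_one (ha : 2 ≤ a) (hroot : α ^ 3 - (a : ℂ) * α ^ 2 + α - 1 = 0)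
    (hnonreal : α.im ≠ 0) : ‖α‖ < 1 := by
  have h := normSq_lt_one ha (normSq_root hroot hnonreal)
  rw [Complex.normSq_eq_norm_sq] at h
  nlinarith [norm_nonneg α]

theorem sq_eq_root (α : ℂ) : α ^ 2 = (2 * α.re : ℝ) * α - (Complex.normSq α : ℝ) := by
  rw [Complex.normSq_apply]
  apply Complex.ext <;> simp [pow_two, Complex.mul_re, Complex.mul_im] <;> ring

theorem re_im_bound (hnonreal : α.im ≠ 0) {r s C : ℝ} (h : ‖(r : ℂ) + s * α‖ ≤ C) :
    |r| ≤ C + |α.re / α.im| * C := by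
  set E := (r : ℂ) + s * α with hE
  have h1 : r = E.re - α.re / α.im * E.im := by
    simp [hE]
    field_simp
    ring
  calc |r| = |E.re - α.re / α.im * E.im| := by rw [← h1]
    _ ≤ |E.re| + |α.re / α.im * E.im| := abs_sub _ _
    _ ≤ C + |α.re / α.im| * C := by
      rw [abs_mul]
      gcongr
      · exact (Complex.abs_re_le_norm E).trans h
      · exact (Complex.abs_im_le_norm E).trans h

theorem tail_bound (hα : ‖α‖ < 1) {d : ℕ → ℤ} {D : ℝ} (hd : ∀ i, |(d i : ℝ)| ≤ D) {z : ℂ}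
    (hz : HasSum (fun i : ℕ => (d i : ℂ) * α ^ (i + 2)) z) (k : ℕ) :
    ‖z - ∑ i ∈ Finset.range k, (d i : ℂ) * α ^ (i + 2)‖ ≤ D * (1 - ‖α‖)⁻¹ * ‖α‖ ^ k := by
  have h1 := (hasSum_nat_add_iff' k).2 hz
  rw [← h1.tsum_eq]
  have h2 : HasSum (fun i : ℕ => D * ‖α‖ ^ k * ‖α‖ ^ i) (D * ‖α‖ ^ k * (1 - ‖α‖)⁻¹) :=
    (hasSum_geometric_of_lt_one (norm_nonneg α) hα).mul_left _
  have hD : 0 ≤ D := (abs_nonneg _).trans (hd 0)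
  refine (tsum_of_norm_bounded h2 fun i => ?_).trans (le_of_eq (by ring))
  rw [norm_mul, norm_pow, Complex.norm_intCast, mul_assoc, ← pow_add]
  have : ‖α‖ ^ (i + k + 2) ≤ ‖α‖ ^ (k + i) :=
    pow_le_pow_of_le_one (norm_nonneg α) hα.le (by omega)
  exact mul_le_mul (hd _) this (by positivity) hD

/-- Dividing the invariant by α^k bounds the remainder. Its first coordinate in the basis 1, α is W
(k+1) − g W k, and g < 1 makes this a contraction. -/
theorem IsCarry.bounded (ha : 2 ≤ a) (hroot : α ^ 3 - (a : ℂ) * α ^ 2 + α - 1 = 0)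
    (hnonreal : α.im ≠ 0) {d W : ℕ → ℤ} (hW : IsCarry a d W) {D : ℝ}
    (hd : ∀ i, |(d i : ℝ)| ≤ D)
    (hz : HasSum (fun i : ℕ => (d i : ℂ) * α ^ (i + 2)) (W 1 * (1 - α) + W 2 * α)) :
    ∃ M : ℤ, ∀ k, |W k| ≤ M := by
  have hα := norm_lt_one ha hroot hnonreal
  have hα0 : α ≠ 0 := by rintro rfl; simp at hnonreal
  have hg1 := normSq_lt_one ha (normSq_root hroot hnonreal)
  have hg0 := Complex.normSq_nonneg α
  set C := D * (1 - ‖α‖)⁻¹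
  have hE : ∀ k, ‖(W k : ℂ) * α ^ 2 + W (k + 1) * (1 - α) + W (k + 2) * α‖ ≤ C := fun k => by
    have h1 := tail_bound hα hd hz k
    have h2 := hW.sum_add (isRec_pow a hroot) k
    have h3 : (W 1 * (1 - α) + W 2 * α : ℂ) -
        ∑ i ∈ Finset.range k, (d i : ℂ) * α ^ (i + 2) =
        α ^ k * ((W k : ℂ) * α ^ 2 + W (k + 1) * (1 - α) + W (k + 2) * α) := by
      simp only [pow_zero, pow_one] at h2
      rw [← h2]
      ring
    rw [h3, norm_mul, norm_pow, mul_comm] at h1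
    exact le_of_mul_le_mul_right h1 (pow_pos (norm_pos_iff.2 hα0) k)
  set g := Complex.normSq α
  set C' := C + |α.re / α.im| * C
  have hstep : ∀ k, |(W (k + 1) : ℝ) - g * W k| ≤ C' := fun k => by
    refine re_im_bound hnonreal
      (s := W k * (2 * α.re) - W (k + 1) + W (k + 2)) (le_of_eq_of_le ?_ (hE k))
    rw [sq_eq_root α]
    change _ = ‖(W k : ℂ) * ((2 * α.re : ℝ) * α - (g : ℝ)) + _ + _‖
    push_cast
    ring_nf
  have hC' : 0 ≤ C' := (abs_nonneg _).trans (hstep 0)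
  have hb : ∀ k, |(W k : ℝ)| ≤ C' / (1 - g) := fun k => by
    have h1g : 0 < 1 - g := by linarith
    induction k with
    | zero => simp [hW.1]; positivity
    | succ k ih =>
      calc |(W (k + 1) : ℝ)| = |(W (k + 1) - g * W k) + g * W k| := by ring_nf
        _ ≤ |(W (k + 1) : ℝ) - g * W k| + |g * W k| := abs_add_le _ _
        _ ≤ C' + g * (C' / (1 - g)) := by
          rw [abs_mul, abs_of_nonneg hg0]
          gcongr
          exact hstep k
        _ = C' / (1 - g) := by field_simp; ring
  refine ⟨⌈C' / (1 - g)⌉, fun k => ?_⟩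
  have := (hb k).trans (Int.le_ceil _)
  exact_mod_cast this

end Root

end GRauzy

/-! ### Descent to carries in {−1, 0, 1}. -/

namespace GRauzy
open Filter Topology

section Descent

variable {a : ℕ} {d W : ℕ → ℤ} {g : ℝ}

theorem eventually_le_of_descent {M₀ : ℤ} (hb : ∃ M : ℤ, ∀ᶠ k in atTop, |W k| ≤ M)
    (h : ∀ M : ℤ, M₀ < M → (∀ᶠ k in atTop, |W k| ≤ M) → ∀ᶠ k in atTop, |W k| ≤ M - 1) :
    ∀ᶠ k in atTop, |W k| ≤ M₀ := by
  obtain ⟨M, hM⟩ := hb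
  obtain ⟨n, hn⟩ : ∃ n : ℕ, M ≤ M₀ + n := ⟨(M - M₀).toNat, by omega⟩
  induction n generalizing M with
  | zero => exact hM.mono fun k hk => hk.trans (by simpa using hn)
  | succ n ih =>
    by_cases hlt : M₀ < M
    · exact ih (M - 1) (h M hlt hM) (by push_cast at hn; linarith)
    · exact hM.mono fun k hk => by omega

/-- The coefficients g − g² and g add up to 1 − (1 − g)², so |W k| < 201/200 + M(1 − (1 − g)²) ≤ M.
The excess of 201/200 over 1 is slack for a term tending to 0. -/
theorem descent_step (hg0 : 0 < g) (hg1 : g < 1) {M : ℤ}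
    (hM : 201 / 200 ≤ (M : ℝ) * (1 - g) ^ 2)
    (hD : ∀ᶠ k in atTop, |(W k : ℝ) - (g - g ^ 2) * W (k + 1) + g * W (k + 2)| < 201 / 200)
    (hb : ∀ᶠ k in atTop, |W k| ≤ M) : ∀ᶠ k in atTop, |W k| ≤ M - 1 := by
  filter_upwards [hD, (tendsto_add_atTop_nat 1).eventually hb,
    (tendsto_add_atTop_nat 2).eventually hb] with k h0 h1 h2
  have h1' : |(W (k + 1) : ℝ)| ≤ M := by exact_mod_cast h1
  have h2' : |(W (k + 2) : ℝ)| ≤ M := by exact_mod_cast h2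
  rw [abs_le] at h1' h2'
  rw [abs_lt] at h0
  have hgg : 0 ≤ g - g ^ 2 := by nlinarith
  have e1 := mul_le_mul_of_nonneg_left h1'.1 hgg
  have e2 := mul_le_mul_of_nonneg_left h1'.2 hgg
  have e3 := mul_le_mul_of_nonneg_left h2'.1 hg0.le
  have e4 := mul_le_mul_of_nonneg_left h2'.2 hg0.le
  have hlt : (W k : ℝ) < M := by nlinarith
  have hgt : -(M : ℝ) < W k := by nlinarith
  have hlt' : W k < M := by exact_mod_cast hlt
  have hgt' : -M < W k := by exact_mod_cast hgt
  rw [abs_le]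
  omega

theorem root_lower (g c : ℝ) (ha : 2 ≤ a) (hg : g ^ 3 - g ^ 2 + a * g - 1 = 0)
    (hc : c ^ 3 - c ^ 2 + a * c - 1 < 0) : c < g := by
  have ha' : (2 : ℝ) ≤ a := by exact_mod_cast ha
  by_contra h
  push Not at h
  have : 0 < c ^ 2 + c * g + g ^ 2 - (c + g) + a := by
    nlinarith [sq_nonneg (c + g - 1), sq_nonneg (c - g), sq_nonneg (c + g)]
  nlinarith [mul_nonneg (sub_nonneg.2 h) this.le]

theorem root_upper (g c : ℝ) (ha : 2 ≤ a) (hg : g ^ 3 - g ^ 2 + a * g - 1 = 0)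
    (hc : 0 < c ^ 3 - c ^ 2 + a * c - 1) : g < c := by
  have ha' : (2 : ℝ) ≤ a := by exact_mod_cast ha
  by_contra h
  push Not at h
  have : 0 < c ^ 2 + c * g + g ^ 2 - (c + g) + a := by
    nlinarith [sq_nonneg (c + g - 1), sq_nonneg (c - g), sq_nonneg (c + g)]
  nlinarith [mul_nonneg (sub_nonneg.2 h) this.le]

/-- Integer form of the contraction inequality for the carries, for a rational approximation
`b / 1000`, `c / 1000` of `g - g²`, `g`. -/
theorem integer_defect {w₀ w₁ w₂ M b c e : ℤ}
    (hD : |(w₀ : ℝ) - (g - g ^ 2) * w₁ + g * w₂| < 201 / 200)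
    (h1 : |w₁| ≤ M) (h2 : |w₂| ≤ M)
    (hb : |1000 * (g - g ^ 2) - b| ≤ 1 / 3) (hc : |1000 * g - c| ≤ 1 / 5)
    (he : 1005 + (M : ℝ) * (8 / 15) ≤ e) :
    |1000 * w₀ - b * w₁ + c * w₂| ≤ e := by
  have h1' : |(w₁ : ℝ)| ≤ M := by exact_mod_cast h1
  have h2' : |(w₂ : ℝ)| ≤ M := by exact_mod_cast h2
  have key : |(1000 * w₀ - b * w₁ + c * w₂ : ℝ)| ≤ e := by
    calc |(1000 * w₀ - b * w₁ + c * w₂ : ℝ)|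
        = |1000 * ((w₀ : ℝ) - (g - g ^ 2) * w₁ + g * w₂) +
          ((1000 * (g - g ^ 2) - b) * w₁ - (1000 * g - c) * w₂)| := by ring_nf
      _ ≤ |1000 * ((w₀ : ℝ) - (g - g ^ 2) * w₁ + g * w₂)| +
          (|(1000 * (g - g ^ 2) - b) * w₁| + |(1000 * g - c) * w₂|) :=
        (abs_add_le _ _).trans (by gcongr; exact abs_sub _ _)
      _ ≤ 1000 * (201 / 200) + (1 / 3 * M + 1 / 5 * M) := by
        rw [abs_mul, abs_mul, abs_mul]
        gcongr
        · norm_num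
      _ ≤ e := by linarith
  exact_mod_cast key

/-- Pairs of consecutive inequalities lower the bound from 5 to 2 and show that ±2 recurs with
opposite sign two places later. Excluding this alternation needs the digit bound. -/
theorem descent_two (hd : ∀ k, |d k| ≤ 1) (hW : IsCarry 2 d W)
    (hg : g ^ 3 - g ^ 2 + (2 : ℕ) * g - 1 = 0)
    (hD : ∀ᶠ k in atTop, |(W k : ℝ) - (g - g ^ 2) * W (k + 1) + g * W (k + 2)| < 201 / 200)
    (hb : ∀ᶠ k in atTop, |W k| ≤ 5) : ∀ᶠ k in atTop, |W k| ≤ 1 := by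
  have l := root_lower g 0.5698 le_rfl hg (by norm_num)
  have u := root_upper g 0.5699 le_rfl hg (by norm_num)
  -- Here 245 and 570 approximate 1000(g − g²) and 1000g, and 1008 exceeds 1005 + 5 · 8/15.
  have hC : ∀ᶠ k in atTop, |1000 * W k - 245 * W (k + 1) + 570 * W (k + 2)| ≤ 1008 := by
    filter_upwards [hD, (tendsto_add_atTop_nat 1).eventually hb,
      (tendsto_add_atTop_nat 2).eventually hb] with k h0 h1 h2
    refine integer_defect h0 h1 h2 ?_ ?_ (by norm_num)
    · rw [abs_le]; push_cast; constructor <;> nlinarith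
    · rw [abs_le]; push_cast; constructor <;> linarith
  obtain ⟨m, hm⟩ := eventually_atTop.1 (hC.and hb)
  have hC : ∀ k, m ≤ k → -1008 ≤ 1000 * W k - 245 * W (k + 1) + 570 * W (k + 2) ∧
      1000 * W k - 245 * W (k + 1) + 570 * W (k + 2) ≤ 1008 := fun k hk => abs_le.1 (hm k hk).1
  have b5 : ∀ k, m ≤ k → -5 ≤ W k ∧ W k ≤ 5 := fun k hk => abs_le.1 (hm k hk).2
  have hd' : ∀ k, -1 ≤ W k - 2 * W (k + 1) + W (k + 2) - W (k + 3) ∧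
      W k - 2 * W (k + 1) + W (k + 2) - W (k + 3) ≤ 1 := fun k => by
    have h1 := abs_le.1 (hd k)
    have h2 := hW.2 k
    push_cast at h2
    omega
  have b4 : ∀ k, m ≤ k → -4 ≤ W k ∧ W k ≤ 4 := fun k hk => by
    have h0 := hC k hk
    have h1 := hC (k + 1) (by omega)
    have g1 := b5 (k + 1) (by omega)
    have g2 := b5 (k + 2) (by omega)
    have g3 := b5 (k + 3) (by omega)
    simp only [add_assoc, Nat.reduceAdd] at h0 h1
    omega
  have b3 : ∀ k, m ≤ k → -3 ≤ W k ∧ W k ≤ 3 := fun k hk => by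
    have h0 := hC k hk
    have h1 := hC (k + 1) (by omega)
    have g1 := b4 (k + 1) (by omega)
    have g2 := b4 (k + 2) (by omega)
    have g3 := b4 (k + 3) (by omega)
    simp only [add_assoc, Nat.reduceAdd] at h0 h1
    omega
  have b2 : ∀ k, m ≤ k → -2 ≤ W k ∧ W k ≤ 2 := fun k hk => by
    have h0 := hC k hk
    have h1 := hC (k + 1) (by omega)
    have g1 := b3 (k + 1) (by omega)
    have g2 := b3 (k + 2) (by omega)
    have g3 := b3 (k + 3) (by omega)
    simp only [add_assoc, Nat.reduceAdd] at h0 h1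
    have v1 : W (k + 1) = -3 ∨ W (k + 1) = -2 ∨ W (k + 1) = -1 ∨ W (k + 1) = 0 ∨ W (k + 1) = 1 ∨
      W (k + 1) = 2 ∨ W (k + 1) = 3 := by omega
    have v2 : W (k + 2) = -3 ∨ W (k + 2) = -2 ∨ W (k + 2) = -1 ∨ W (k + 2) = 0 ∨ W (k + 2) = 1 ∨
      W (k + 2) = 2 ∨ W (k + 2) = 3 := by omega
    rcases v1 with v1 | v1 | v1 | v1 | v1 | v1 | v1 <;>
      rcases v2 with v2 | v2 | v2 | v2 | v2 | v2 | v2 <;> omega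
  have s2 : ∀ k, m ≤ k → (W k = 2 → W (k + 2) = -2 ∧ (W (k + 1) = 0 ∨ W (k + 1) = 1)) ∧
      (W k = -2 → W (k + 2) = 2 ∧ (W (k + 1) = 0 ∨ W (k + 1) = -1)) := fun k hk => by
    have h0 := hC k hk
    have h1 := hC (k + 1) (by omega)
    have g1 := b2 (k + 1) (by omega)
    have g2 := b2 (k + 2) (by omega)
    have g3 := b2 (k + 3) (by omega)
    simp only [add_assoc, Nat.reduceAdd] at h0 h1
    have v1 : W (k + 1) = -2 ∨ W (k + 1) = -1 ∨ W (k + 1) = 0 ∨ W (k + 1) = 1 ∨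
      W (k + 1) = 2 := by omega
    have v2 : W (k + 2) = -2 ∨ W (k + 2) = -1 ∨ W (k + 2) = 0 ∨ W (k + 2) = 1 ∨
      W (k + 2) = 2 := by omega
    rcases v1 with v1 | v1 | v1 | v1 | v1 <;> rcases v2 with v2 | v2 | v2 | v2 | v2 <;> omega
  refine eventually_atTop.2 ⟨m, fun k hk => ?_⟩
  have h0 := s2 k hk
  have h2 := s2 (k + 2) (by omega)
  have h4 := s2 (k + 4) (by omega)
  -- If W k = 2, the signs alternate at k + 2, k + 4, k + 6. The digit bound at k + 1 forces W (k+3)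
  -- = −1, that at k + 3 forces W (k+3) = 0. The case −2 is symmetric.
  have e1 := hd' (k + 1)
  have e3 := hd' (k + 3)
  have e2 := hd' (k + 2)
  have g0 := b2 k hk
  simp only [add_assoc, Nat.reduceAdd] at h0 h2 h4 e1 e2 e3
  rw [abs_le]
  omega

theorem descent_three (hg : g ^ 3 - g ^ 2 + (3 : ℕ) * g - 1 = 0)
    (hD : ∀ᶠ k in atTop, |(W k : ℝ) - (g - g ^ 2) * W (k + 1) + g * W (k + 2)| < 201 / 200)
    (hb : ∀ᶠ k in atTop, |W k| ≤ 2) : ∀ᶠ k in atTop, |W k| ≤ 1 := by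
  have l := root_lower g 0.3611 (by norm_num) hg (by norm_num)
  have u := root_upper g 0.3612 (by norm_num) hg (by norm_num)
  have hC : ∀ᶠ k in atTop, |1000 * W k - 231 * W (k + 1) + 361 * W (k + 2)| ≤ 1007 := by
    filter_upwards [hD, (tendsto_add_atTop_nat 1).eventually hb,
      (tendsto_add_atTop_nat 2).eventually hb] with k h0 h1 h2
    refine integer_defect h0 h1 h2 ?_ ?_ (by norm_num)
    · rw [abs_le]; push_cast; constructor <;> nlinarith
    · rw [abs_le]; push_cast; constructor <;> linarith
  obtain ⟨m, hm⟩ := eventually_atTop.1 (hC.and hb)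
  refine eventually_atTop.2 ⟨m, fun k hk => ?_⟩
  have h0 := abs_le.1 (hm k hk).1
  have h1 := abs_le.1 (hm (k + 1) (by omega)).1
  have g0 := abs_le.1 (hm k hk).2
  have g1 := abs_le.1 (hm (k + 1) (by omega)).2
  have g2 := abs_le.1 (hm (k + 2) (by omega)).2
  have g3 := abs_le.1 (hm (k + 3) (by omega)).2
  simp only [add_assoc, Nat.reduceAdd] at h0 h1 g0 g1 g2 g3
  rw [abs_le]
  have v1 : W (k + 1) = -2 ∨ W (k + 1) = -1 ∨ W (k + 1) = 0 ∨ W (k + 1) = 1 ∨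
    W (k + 1) = 2 := by omega
  have v2 : W (k + 2) = -2 ∨ W (k + 2) = -1 ∨ W (k + 2) = 0 ∨ W (k + 2) = 1 ∨
    W (k + 2) = 2 := by omega
  rcases v1 with v1 | v1 | v1 | v1 | v1 <;> rcases v2 with v2 | v2 | v2 | v2 | v2 <;> omega

theorem eventually_carry_le_one (ha : 2 ≤ a) (hg : g ^ 3 - g ^ 2 + a * g - 1 = 0)
    (hd : ∀ k, |d k| + 1 ≤ a) (hW : IsCarry a d W)
    (hD : ∀ᶠ k in atTop, |(W k : ℝ) - (g - g ^ 2) * W (k + 1) + g * W (k + 2)| < 201 / 200)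
    (hb : ∃ M : ℤ, ∀ k, |W k| ≤ M) : ∀ᶠ k in atTop, |W k| ≤ 1 := by
  have hg0 : 0 < g := root_lower g 0 ha hg (by norm_num)
  have hg1 : g < 1 := normSq_lt_one ha hg
  have hb' : ∃ M : ℤ, ∀ᶠ k in atTop, |W k| ≤ M := hb.imp fun M h => Eventually.of_forall h
  -- `descent_step` applies for M ≥ 6, 3, 2 respectively; the smaller bounds for a = 2, 3 need the
  -- finite case checks.
  rcases (show a = 2 ∨ a = 3 ∨ 4 ≤ a by omega) with rfl | rfl | h4
  · refine descent_two (fun k => ?_) hW hg hD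
      (eventually_le_of_descent hb' fun M hM => descent_step hg0 hg1 ?_ hD)
    · have := hd k; push_cast at this; linarith
    · have u := root_upper g 0.5699 le_rfl hg (by norm_num)
      have : (6 : ℝ) ≤ M := by exact_mod_cast hM
      nlinarith
  · refine descent_three hg hD
      (eventually_le_of_descent hb' fun M hM => descent_step hg0 hg1 ?_ hD)
    have u := root_upper g 0.3612 (by norm_num) hg (by norm_num)
    have : (3 : ℝ) ≤ M := by exact_mod_cast hM
    nlinarith
  · refine eventually_le_of_descent hb' fun M hM => descent_step hg0 hg1 ?_ hD
    have h4' : (4 : ℝ) ≤ a := by exact_mod_cast h4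
    have u := root_upper g 0.27 ha hg (by norm_num; linarith)
    have : (2 : ℝ) ≤ M := by exact_mod_cast hM
    nlinarith

end Descent

end GRauzy

/-! ### The inequality from the real conjugate 1/g. -/

namespace GRauzy
open Filter Topology

/-- The quantity by which the real conjugate controls three consecutive carries. -/
def defect (g : ℝ) (W : ℕ → ℤ) (k : ℕ) : ℝ :=
  (W k : ℝ) - (g - g ^ 2) * W (k + 1) + g * W (k + 2)

/-- A prefix of a digit string, evaluated in the base `1 / g` and scaled to lie in `[0, 1)`. -/
noncomputable def scaledPrefix (g : ℝ) (ε : ℕ → ℕ) (k : ℕ) : ℝ :=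
  g ^ k * ∑ i ∈ Finset.range k, (ε i : ℝ) * g⁻¹ ^ i

section Real

variable {a : ℕ} {g : ℝ} {ε ε' : ℕ → ℕ}

theorem root_pos (ha : 2 ≤ a) (hg : g ^ 3 - g ^ 2 + a * g - 1 = 0) : 0 < g :=
  root_lower g 0 ha hg (by norm_num)

theorem inv_root (ha : 2 ≤ a) (hg : g ^ 3 - g ^ 2 + a * g - 1 = 0) :
    g⁻¹ ^ 3 - (a : ℝ) * g⁻¹ ^ 2 + g⁻¹ - 1 = 0 := by
  have := root_pos ha hg
  field_simp
  linear_combination -hg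

theorem lt_inv_root (ha : 2 ≤ a) (hg : g ^ 3 - g ^ 2 + a * g - 1 = 0) : (a : ℝ) - 1 < g⁻¹ := by
  have h0 := root_pos ha hg
  have h1 := normSq_lt_one ha hg
  rw [lt_inv_comm₀ (by have : (2 : ℝ) ≤ a := by exact_mod_cast ha
                       linarith) h0, lt_inv_comm₀ h0 (by
                       have : (2 : ℝ) ≤ a := by exact_mod_cast ha
                       linarith), ← one_div, lt_div_iff₀ h0]
  nlinarith [mul_pos h0 h0]

theorem scaledPrefix_nonneg (h0 : 0 < g) (k : ℕ) : 0 ≤ scaledPrefix g ε k := by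
  unfold scaledPrefix
  positivity

theorem Admissible.scaledPrefix_lt_one (ha : 2 ≤ a) (h : Admissible a ε)
    (hg : g ^ 3 - g ^ 2 + a * g - 1 = 0) (k : ℕ) : scaledPrefix g ε k < 1 := by
  have h0 := root_pos ha hg
  have := h.sum_pow_lt ha (inv_root ha hg) (lt_inv_root ha hg) k
  calc scaledPrefix g ε k < g ^ k * g⁻¹ ^ k := mul_lt_mul_of_pos_left this (pow_pos h0 k)
    _ = 1 := by rw [← mul_pow, mul_inv_cancel₀ h0.ne', one_pow]

theorem scaledPrefix_tendsto_zero (h0 : 0 < g) (h1 : g < 1) {m : ℕ} (hm : ∀ i, m ≤ i → ε i = 0) :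
    Tendsto (scaledPrefix g ε) atTop (𝓝 0) := by
  have h2 : Tendsto (fun k => g ^ k * ∑ i ∈ Finset.range m, (ε i : ℝ) * g⁻¹ ^ i) atTop (𝓝 0) := by
    simpa using (tendsto_pow_atTop_nhds_zero_of_lt_one h0.le h1).mul_const
      (∑ i ∈ Finset.range m, (ε i : ℝ) * g⁻¹ ^ i)
  refine h2.congr' (eventually_atTop.2 ⟨m, fun k hk => ?_⟩)
  unfold scaledPrefix
  congr 1
  refine Finset.sum_subset (Finset.range_mono hk) fun i _ hi => ?_
  simp [hm i (by simpa using hi)]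

/-- The invariant for powers of 1/g, multiplied by g^(k+2). The period then contributes a term
tending to 0. -/
theorem IsCarry.defect_eq {W : ℕ → ℤ} (ha : 2 ≤ a) (hg : g ^ 3 - g ^ 2 + a * g - 1 = 0)
    (hW : IsCarry a (fun i => (ε i : ℤ) - ε' i) W) (k : ℕ) :
    defect g W k = g ^ k * (g ^ 2 * (W 1 * (1 - g⁻¹) + W 2 * g⁻¹)) - scaledPrefix g ε k +
      scaledPrefix g ε' k := by
  have h0 := root_pos ha hg
  have h := hW.sum_add (isRec_pow a (inv_root ha hg)) k
  have hk : g ^ k * g⁻¹ ^ k = 1 := by rw [← mul_pow, mul_inv_cancel₀ h0.ne', one_pow]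
  have hi : g * g⁻¹ = 1 := mul_inv_cancel₀ h0.ne'
  have hs : ∑ i ∈ Finset.range k, (((ε i : ℤ) - ε' i : ℤ) : ℝ) * g⁻¹ ^ (i + 2) =
      g⁻¹ ^ 2 * (∑ i ∈ Finset.range k, (ε i : ℝ) * g⁻¹ ^ i -
        ∑ i ∈ Finset.range k, (ε' i : ℝ) * g⁻¹ ^ i) := by
    rw [← Finset.sum_sub_distrib, Finset.mul_sum]
    exact Finset.sum_congr rfl fun i _ => by push_cast; ring
  simp only [pow_zero, pow_one] at h
  rw [hs] at h
  rw [← h]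
  unfold scaledPrefix defect
  generalize g⁻¹ = b at *
  generalize ∑ i ∈ Finset.range k, (ε i : ℝ) * b ^ i = S
  generalize ∑ i ∈ Finset.range k, (ε' i : ℝ) * b ^ i = S'
  have hbk : b ^ (k + 2) = b ^ k * b ^ 2 := pow_add _ _ _
  have hbk1 : b ^ (k + 1) = b ^ k * b := pow_succ _ _
  rw [hbk, hbk1]
  have e : g ^ k * (g ^ 2 * (b ^ 2 * (S - S') + ((W k : ℝ) * (b ^ k * b ^ 2) +
      W (k + 1) * (b ^ k - b ^ k * b) + W (k + 2) * (b ^ k * b)))) =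
      g ^ k * (g * b) ^ 2 * (S - S') + (g ^ k * b ^ k) * ((g * b) ^ 2 * W k +
        W (k + 1) * (g ^ 2 - g * (g * b)) + W (k + 2) * g * (g * b)) := by ring
  rw [e, hk, hi]
  ring

theorem tendsto_pow_mul (h0 : 0 < g) (h1 : g < 1) (c : ℝ) :
    Tendsto (fun k : ℕ => g ^ k * c) atTop (𝓝 0) := by
  simpa using (tendsto_pow_atTop_nhds_zero_of_lt_one h0.le h1).mul_const c

theorem IsCarry.eventually_abs_defect_lt {W : ℕ → ℤ} (ha : 2 ≤ a)
    (hg : g ^ 3 - g ^ 2 + a * g - 1 = 0) (hε : Admissible a ε) (hε' : Admissible a ε')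
    (hW : IsCarry a (fun i => (ε i : ℤ) - ε' i) W) :
    ∀ᶠ k in atTop, |defect g W k| < 201 / 200 := by
  have h0 := root_pos ha hg
  have h1 := normSq_lt_one ha hg
  have ht := tendsto_pow_mul h0 h1 (g ^ 2 * (W 1 * (1 - g⁻¹) + W 2 * g⁻¹))
  filter_upwards [ht.eventually (Metric.ball_mem_nhds 0 (show (0 : ℝ) < 1 / 200 by norm_num))]
    with k hk
  rw [Real.dist_eq, sub_zero, abs_lt] at hk
  rw [hW.defect_eq ha hg, abs_lt]
  have e1 := hε.scaledPrefix_lt_one ha hg k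
  have e2 := hε'.scaledPrefix_lt_one ha hg k
  have e3 := scaledPrefix_nonneg (ε := ε) h0 k
  have e4 := scaledPrefix_nonneg (ε := ε') h0 k
  constructor <;> linarith [hk.1, hk.2]

theorem IsCarry.eventually_defect_lt {W : ℕ → ℤ} (ha : 2 ≤ a)
    (hg : g ^ 3 - g ^ 2 + a * g - 1 = 0)
    (hW : IsCarry a (fun i => (ε i : ℤ) - ε' i) W) {m : ℕ} (hm : ∀ i, m ≤ i → ε' i = 0) :
    ∀ᶠ k in atTop, defect g W k < 1 / 10 := by
  have h0 := root_pos ha hg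
  have h1 := normSq_lt_one ha hg
  have ht := (tendsto_pow_mul h0 h1 (g ^ 2 * (W 1 * (1 - g⁻¹) + W 2 * g⁻¹))).add
    (scaledPrefix_tendsto_zero h0 h1 hm)
  rw [add_zero] at ht
  filter_upwards [ht.eventually_lt_const (show (0 : ℝ) < 1 / 10 by norm_num)] with k hk
  rw [hW.defect_eq ha hg]
  linarith [scaledPrefix_nonneg (ε := ε) h0 k]

end Real

/-! ### Backward propagation, and carries against a finite string. -/

section Carries

variable {a : ℕ} {W : ℕ → ℤ} {ε ε' : ℕ → ℕ}

/-- The carries at two consecutive later positions bound the carry at an earlier one. -/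
theorem IsCarry.abs_mul_lt (hε : Admissible a ε)
    (hε' : Admissible a ε') (ha : 2 ≤ a) (hW : IsCarry a (fun i => (ε i : ℤ) - ε' i) W) (k : ℕ) :
    |W k * impulse a (k + 2) + W (k + 1) * (impulse a k - impulse a (k + 1)) +
      W (k + 2) * impulse a (k + 1)| < impulse a (k + 2) := by
  have h := hW.sum_impulse k
  simp only [sub_mul, Finset.sum_sub_distrib] at h
  have h1 := hε.sum_lt k
  have h2 := hε'.sum_lt k
  have h3 := sum_impulse_nonneg ha ε k
  have h4 := sum_impulse_nonneg ha ε' k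
  rw [abs_lt]
  constructor <;> linarith

theorem forall_of_eventually_of_descent {P : ℤ → Prop} (h : ∀ᶠ k in atTop, P (W k))
    (hs : ∀ k, P (W (k + 1)) → P (W (k + 2)) → P (W k)) (k : ℕ) : P (W k) := by
  obtain ⟨m, hm⟩ := eventually_atTop.1 h
  have : ∀ n k, m ≤ k + n → P (W k) := fun n => by
    induction n with
    | zero => exact fun k hk => hm k hk
    | succ n ih => exact fun k hk => hs k (ih _ (by omega)) (ih _ (by omega))
  exact this m k (by omega)

/-- With F = `impulse a`, two later carries of size at most 1 give |W k| F(k+2) < F(k+2) + 2F(k+1) −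
F(k) ≤ 2F(k+2) by convexity. -/
theorem IsCarry.forall_abs_le_one (hε : Admissible a ε)
    (hε' : Admissible a ε') (ha : 2 ≤ a) (hW : IsCarry a (fun i => (ε i : ℤ) - ε' i) W)
    (h : ∀ᶠ k in atTop, |W k| ≤ 1) (k : ℕ) : |W k| ≤ 1 := by
  refine forall_of_eventually_of_descent (P := fun w => |w| ≤ 1) h (fun k h1 h2 => ?_) k
  have h0 := abs_lt.1 (hW.abs_mul_lt hε hε' ha k)
  rw [abs_le] at h1 h2
  have hc := impulse_convex ha k
  have hp := impulse_pos ha k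
  have hm := (impulse_growth ha k).2.1
  have hn := impulse_nonneg ha (k + 1)
  have e1 := mul_le_mul_of_nonneg_right h1.1 (sub_nonneg.2 hm)
  have e2 := mul_le_mul_of_nonneg_right h1.2 (sub_nonneg.2 hm)
  have e3 := mul_le_mul_of_nonneg_right h2.1 hn
  have e4 := mul_le_mul_of_nonneg_right h2.2 hn
  have u : W k * impulse a (k + 2) < 2 * impulse a (k + 2) := by linarith
  have l : (-2) * impulse a (k + 2) < W k * impulse a (k + 2) := by linarith
  have u' := lt_of_mul_lt_mul_right u hp.le
  have l' := lt_of_mul_lt_mul_right l hp.le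
  rw [abs_le]
  omega

theorem IsCarry.forall_eq_zero (hε : Admissible a ε)
    (hε' : Admissible a ε') (ha : 2 ≤ a) (hW : IsCarry a (fun i => (ε i : ℤ) - ε' i) W)
    (h : ∀ᶠ k in atTop, W k = 0) (k : ℕ) : W k = 0 := by
  refine forall_of_eventually_of_descent (P := fun w => w = 0) h (fun k h1 h2 => ?_) k
  have h0 := abs_lt.1 (hW.abs_mul_lt hε hε' ha k)
  rw [h1, h2] at h0
  have hp := impulse_pos ha k
  have u : W k * impulse a (k + 2) < 1 * impulse a (k + 2) := by linarith
  have l : (-1) * impulse a (k + 2) < W k * impulse a (k + 2) := by linarith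
  have u' := lt_of_mul_lt_mul_right u hp.le
  have l' := lt_of_mul_lt_mul_right l hp.le
  omega

/-- Late carries lie in {0, −1} and are driven by `ε` alone. A zero persists, as leaving it would
violate greediness at a pair of digits a − 1. Carries constantly −1 would make all late digits a −
1. -/
theorem IsCarry.eventually_eq_zero {g : ℝ} (ha : 2 ≤ a)
    (hg : g ^ 3 - g ^ 2 + a * g - 1 = 0) (hε : Admissible a ε)
    (hW : IsCarry a (fun i => (ε i : ℤ) - ε' i) W) {m : ℕ} (hm : ∀ i, m ≤ i → ε' i = 0)
    (hone : ∀ k, |W k| ≤ 1) : ∀ᶠ k in atTop, W k = 0 := by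
  have g0 := root_pos ha hg
  have g1 := root_upper g 0.57 ha hg (by
    have : (2 : ℝ) ≤ a := by exact_mod_cast ha
    norm_num; linarith)
  have hneg : ∀ᶠ k in atTop, W k = 0 ∨ W k = -1 := by
    filter_upwards [hW.eventually_defect_lt ha hg hm] with k hk
    have h0 := abs_le.1 (hone k)
    have h1 := abs_le.1 (hone (k + 1))
    have h2 := abs_le.1 (hone (k + 2))
    -- A carry 1 makes the defect at least (1 − g)², which exceeds 1/10 because g < 0.57.
    have hne : W k ≠ 1 := fun hc => by
      unfold defect at hk
      rw [hc] at hk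
      have h1' : (W (k + 1) : ℝ) ≤ 1 := by exact_mod_cast h1.2
      have h2' : (-1 : ℝ) ≤ W (k + 2) := by exact_mod_cast h2.1
      have hgg : 0 ≤ g - g ^ 2 := by nlinarith
      have e1 := mul_le_mul_of_nonneg_left h1' hgg
      have e2 := mul_le_mul_of_nonneg_left h2' g0.le
      push_cast at hk
      nlinarith
    omega
  obtain ⟨n, hn⟩ := eventually_atTop.1 hneg
  by_contra hcon
  rw [eventually_atTop] at hcon
  push Not at hcon
  set N := max n m with hN
  have bin : ∀ k, N ≤ k → W k = 0 ∨ W k = -1 := fun k hk => hn k (by omega)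
  have rec' : ∀ k, N ≤ k → W (k + 3) = W k - a * W (k + 1) + W (k + 2) - ε k := fun k hk => by
    have := hW.2 k
    simpa [hm k (by omega)] using this
  have dig : ∀ k, ε k < a := hε.digit_lt ha
  -- a carry `0, -1` is followed by `-1`
  have up : ∀ k, N ≤ k → W (k + 1) = 0 → W (k + 2) = -1 → W (k + 3) = -1 := fun k hk h1 h2 => by
    have := rec' k hk
    rw [h1, h2] at this
    have b0 := bin k hk
    have b3 := bin (k + 3) (by omega)
    have := dig k
    omega
  have top : ∀ k, N ≤ k → W k = 0 → W (k + 1) = -1 → W (k + 2) = -1 → W (k + 3) = 0 ∧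
      ε k + 1 = a := fun k hk h0 h1 h2 => by
    have := rec' k hk
    rw [h0, h1, h2] at this
    have b3 := bin (k + 3) (by omega)
    have := dig k
    omega
  have top' : ∀ k, N ≤ k → W k = -1 → W (k + 1) = -1 → W (k + 2) = 0 → W (k + 3) = 0 ∧
      ε k + 1 = a := fun k hk h0 h1 h2 => by
    have := rec' k hk
    rw [h0, h1, h2] at this
    have b3 := bin (k + 3) (by omega)
    have := dig k
    omega
  have clash : ∀ k, N ≤ k → W k = 0 → W (k + 1) = -1 → W (k + 2) = -1 → False :=
    fun k hk h0 h1 h2 => by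
    obtain ⟨h3, t0⟩ := top k hk h0 h1 h2
    obtain ⟨-, t1⟩ := top' (k + 1) (by omega) h1 h2 h3
    have hs := hε.sum_lt_of_max t0 t1
    -- For carries 0, −1, −1 the prefix of `ε` equals that of `ε'` plus `impulse a k`, too much
    -- below two maximal digits.
    have hi := hW.sum_impulse k
    simp only [sub_mul, Finset.sum_sub_distrib] at hi
    rw [h0, h1, h2] at hi
    have := sum_impulse_nonneg ha ε' k
    linarith
  by_cases hz : ∃ k, N ≤ k ∧ W (k + 1) = 0
  · obtain ⟨k, hk, hk0⟩ := hz
    have stay : ∀ j, W (k + 1 + j) = 0 := fun j => by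
      induction j with
      | zero => exact hk0
      | succ j ih =>
        rcases bin (k + 1 + (j + 1)) (by omega) with h | h
        · exact h
        · have h3 := up (k + j) (by omega) (by rw [← ih]; congr 1; ring)
            (by rw [← h]; congr 1; ring)
          exact (clash (k + 1 + j) (by omega) ih h (by rw [← h3]; congr 1; ring)).elim
    obtain ⟨j, hj, hj0⟩ := hcon (k + 1)
    exact hj0 (by rw [← stay (j - (k + 1))]; congr 1; omega)
  · push Not at hz
    have hm1 : ∀ k, N < k → W k = -1 := fun k hk => by
      have := hz (k - 1) (by omega)
      rw [show k - 1 + 1 = k by omega] at this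
      exact (bin k (by omega)).resolve_left this
    have hall : ∀ k, N < k → ε k + 1 = a := fun k hk => by
      have := rec' k (by omega)
      rw [hm1 k hk, hm1 (k + 1) (by omega), hm1 (k + 2) (by omega), hm1 (k + 3) (by omega)] at this
      omega
    obtain ⟨j, hj, -, hj1⟩ := hε.zero_of_max ha (hall (N + 2) (by omega)) (hall (N + 3) (by omega))
    have := hall (j + 1) (by omega)
    omega

end Carries

section Expansion

variable {a : ℕ} {α : ℂ} {ε ε' : ℕ → ℕ} {W : ℕ → ℤ} {z z' : ℂ}

theorem digits_sub_abs (hε : Admissible a ε) (hε' : Admissible a ε') (ha : 2 ≤ a) (k : ℕ) :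
    |((ε k : ℤ) - ε' k)| + 1 ≤ a := by
  have h1 := hε.digit_lt ha k
  have h2 := hε'.digit_lt ha k
  have : |((ε k : ℤ) - ε' k)| ≤ a - 1 := abs_le.2 (by omega)
  linarith

theorem carry_abs_le_one (ha : 2 ≤ a) (hroot : α ^ 3 - (a : ℂ) * α ^ 2 + α - 1 = 0)
    (hnonreal : α.im ≠ 0) (hε : Admissible a ε) (hε' : Admissible a ε')
    (hz : HasSum (fun i : ℕ => (ε i : ℂ) * α ^ (i + 2)) z)
    (hz' : HasSum (fun i : ℕ => (ε' i : ℂ) * α ^ (i + 2)) z')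
    (hW : IsCarry a (fun i => (ε i : ℤ) - ε' i) W)
    (h : z - z' = W 1 * (1 - α) + W 2 * α) (k : ℕ) : |W k| ≤ 1 := by
  have hg := normSq_root hroot hnonreal
  have hd := digits_sub_abs hε hε' ha
  have hs := hz.sub hz'
  rw [h] at hs
  refine hW.forall_abs_le_one hε hε' ha (eventually_carry_le_one ha hg hd hW
    (hW.eventually_abs_defect_lt ha hg hε hε')
    (hW.bounded ha hroot hnonreal (D := a) (fun i => ?_) ?_)) k
  · have := hd i
    have : |((ε i : ℤ) - ε' i)| ≤ a := by linarith
    exact_mod_cast this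
  · simpa only [Int.cast_sub, Int.cast_natCast, sub_mul] using hs

theorem carry_eq_zero_of_finite (ha : 2 ≤ a) (hroot : α ^ 3 - (a : ℂ) * α ^ 2 + α - 1 = 0)
    (hnonreal : α.im ≠ 0) (hε : Admissible a ε) (hε' : Admissible a ε')
    (hz : HasSum (fun i : ℕ => (ε i : ℂ) * α ^ (i + 2)) z)
    (hz' : HasSum (fun i : ℕ => (ε' i : ℂ) * α ^ (i + 2)) z')
    (hW : IsCarry a (fun i => (ε i : ℤ) - ε' i) W)
    (h : z - z' = W 1 * (1 - α) + W 2 * α) {m : ℕ} (hm : ∀ i, m ≤ i → ε' i = 0) (k : ℕ) :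
    W k = 0 :=
  hW.forall_eq_zero hε hε' ha (hW.eventually_eq_zero ha (normSq_root hroot hnonreal) hε hm
    (carry_abs_le_one ha hroot hnonreal hε hε' hz hz' hW h)) k

theorem tile_meets (ha : 2 ≤ a) (hroot : α ^ 3 - (a : ℂ) * α ^ 2 + α - 1 = 0)
    (hnonreal : α.im ≠ 0) (hε : Admissible a ε) (hε' : Admissible a ε')
    (hz : HasSum (fun i : ℕ => (ε i : ℂ) * α ^ (i + 2)) z)
    (hz' : HasSum (fun i : ℕ => (ε' i : ℂ) * α ^ (i + 2)) z')
    {p q : ℤ} (h : z - z' = p + q * α) : (p : ℂ) + q * α ∈ insert 0 (sixTranslations α) := by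
  have hW := isCarry_carry a p q (fun i => (ε i : ℤ) - ε' i)
  have hone := carry_abs_le_one ha hroot hnonreal hε hε' hz hz' hW (by
    rw [h]; simp [carry]; ring)
  have hp := abs_le.1 (hone 1)
  have hpq := abs_le.1 (hone 2)
  -- The first two carries still allow ±(1 − 2α); the third excludes it.
  have h3 := abs_le.1 (hone 3)
  have hd := digits_sub_abs hε hε' ha 0
  simp only [carry] at hp hpq h3
  have hd' : |((ε 0 : ℤ) - ε' 0)| ≤ a - 1 := by linarith
  rw [abs_le] at hd'
  have hp3 : p = -1 ∨ p = 0 ∨ p = 1 := by omega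
  simp only [sixTranslations, Set.mem_insert_iff, Set.mem_singleton_iff]
  rcases hp3 with rfl | rfl | rfl
  · have : q = 0 ∨ q = 1 := by omega
    rcases this with rfl | rfl
    · simp
    · right; right; right; right; right; left; push_cast; ring
  · have : q = -1 ∨ q = 0 ∨ q = 1 := by omega
    rcases this with rfl | rfl | rfl <;> simp
  · have : q = -1 ∨ q = 0 := by omega
    rcases this with rfl | rfl
    · right; right; right; right; right; right; push_cast; ring
    · simp

end Expansion

end GRauzy

/-! ### The lattice of periods. -/

namespace GRauzy
open Filter Topology Pointwise

section Lattice

variable {α : ℂ}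

theorem zero_mem_lattice : (0 : ℂ) ∈ lattice α := ⟨0, 0, by simp⟩

theorem add_mem_lattice {u v : ℂ} (hu : u ∈ lattice α) (hv : v ∈ lattice α) :
    u + v ∈ lattice α := by
  obtain ⟨p, q, rfl⟩ := hu
  obtain ⟨r, s, rfl⟩ := hv
  exact ⟨p + r, q + s, by push_cast; ring⟩

theorem neg_mem_lattice {u : ℂ} (hu : u ∈ lattice α) : -u ∈ lattice α := by
  obtain ⟨p, q, rfl⟩ := hu
  exact ⟨-p, -q, by push_cast; ring⟩

theorem sub_mem_lattice {u v : ℂ} (hu : u ∈ lattice α) (hv : v ∈ lattice α) :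
    u - v ∈ lattice α := sub_eq_add_neg u v ▸ add_mem_lattice hu (neg_mem_lattice hv)

theorem intCast_mul_mem_lattice (n : ℤ) {u : ℂ} (hu : u ∈ lattice α) : n * u ∈ lattice α := by
  obtain ⟨p, q, rfl⟩ := hu
  exact ⟨n * p, n * q, by push_cast; ring⟩

theorem sum_mem_lattice {ι : Type*} (s : Finset ι) {f : ι → ℂ} (h : ∀ i ∈ s, f i ∈ lattice α) :
    ∑ i ∈ s, f i ∈ lattice α := by
  classical
  induction s using Finset.induction_on with
  | empty => simpa using zero_mem_lattice
  | insert i s hi ih =>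
    rw [Finset.sum_insert hi]
    exact add_mem_lattice (h i (by simp)) (ih fun j hj => h j (by simp [hj]))

/-- Real coordinates with respect to the basis `1, α`. -/
noncomputable def coords (α z : ℂ) : ℝ × ℝ := (z.re - z.im / α.im * α.re, z.im / α.im)

theorem eq_coords (hα : α.im ≠ 0) (z : ℂ) :
    z = ((coords α z).1 : ℂ) + ((coords α z).2 : ℂ) * α := by
  apply Complex.ext
  · simp [coords]
  · simp [coords, hα]

theorem coords_add_mul (hα : α.im ≠ 0) (p q : ℝ) : coords α ((p : ℂ) + q * α) = (p, q) := by
  simp [coords, hα]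

/-- In coordinates the lattice is ℤ × ℤ, all of whose subsets are closed. The boundary formula uses
the subset without 0. -/
theorem isClosed_of_subset_lattice (hα : α.im ≠ 0) {S : Set ℂ} (hS : S ⊆ lattice α) :
    IsClosed S := by
  have hc : Continuous (coords α) := by unfold coords; fun_prop
  have he : IsClosedEmbedding (Prod.map ((↑) : ℤ → ℝ) ((↑) : ℤ → ℝ)) :=
    Int.isClosedEmbedding_coe_real.prodMap Int.isClosedEmbedding_coe_real
  have : S = coords α ⁻¹' (Prod.map ((↑) : ℤ → ℝ) ((↑) : ℤ → ℝ) ''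
      {x : ℤ × ℤ | (x.1 : ℂ) + x.2 * α ∈ S}) := by
    ext z
    constructor
    · intro hz
      obtain ⟨p, q, rfl⟩ := hS hz
      exact ⟨(p, q), hz, by
        have := coords_add_mul hα p q
        push_cast at this
        rw [this]; rfl⟩
    · rintro ⟨⟨p, q⟩, hx, h⟩
      have h1 := eq_coords hα z
      rw [← h] at h1
      rw [h1]
      simpa using hx
  rw [this]
  exact (he.isClosedMap _ (isClosed_discrete _)).preimage hc

theorem exists_lattice_near (hα : α.im ≠ 0) (z : ℂ) :
    ∃ p q : ℤ, ‖z - (p + q * α)‖ ≤ 1 + ‖α‖ := by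
  refine ⟨⌊(coords α z).1⌋, ⌊(coords α z).2⌋, ?_⟩
  have h : z - (((⌊(coords α z).1⌋ : ℤ) : ℂ) + ((⌊(coords α z).2⌋ : ℤ) : ℂ) * α) =
      ((Int.fract (coords α z).1 : ℝ) : ℂ) + ((Int.fract (coords α z).2 : ℝ) : ℂ) * α := by
    simp only [Int.fract]
    push_cast
    linear_combination eq_coords hα z
  rw [h]
  refine (norm_add_le _ _).trans ?_
  rw [norm_mul, Complex.norm_real, Complex.norm_real, Real.norm_of_nonneg (Int.fract_nonneg _),
    Real.norm_of_nonneg (Int.fract_nonneg _)]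
  have h1 := (Int.fract_lt_one (coords α z).1).le
  have h2 := (Int.fract_lt_one (coords α z).2).le
  nlinarith [norm_nonneg α]

end Lattice

/-! ### Compactness of the fractal and the covering. -/

section Covering

variable {a : ℕ} {α : ℂ}

theorem pow_sub_impulse_mem (hroot : α ^ 3 - (a : ℂ) * α ^ 2 + α - 1 = 0) :
    ∀ k : ℕ, α ^ k - impulse a k * α ^ 2 ∈ lattice α
  | 0 => ⟨1, 0, by simp [impulse]⟩
  | 1 => ⟨0, 1, by simp [impulse]⟩
  | 2 => ⟨0, 0, by simp [impulse]⟩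
  | k + 3 => by
    have h : α ^ (k + 3) - impulse a (k + 3) * α ^ 2 =
        ((a : ℤ) : ℂ) * (α ^ (k + 2) - impulse a (k + 2) * α ^ 2) -
          (α ^ (k + 1) - impulse a (k + 1) * α ^ 2) + (α ^ k - impulse a k * α ^ 2) := by
      have h1 : α ^ (k + 3) = a * α ^ (k + 2) - α ^ (k + 1) + α ^ k := isRec_pow a hroot k
      rw [impulse_isRec a k, h1]
      push_cast
      ring
    rw [h]
    exact add_mem_lattice (sub_mem_lattice (intCast_mul_mem_lattice _
      (pow_sub_impulse_mem hroot _)) (pow_sub_impulse_mem hroot _)) (pow_sub_impulse_mem hroot _)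

theorem exists_greedy (ha : 2 ≤ a) (N : ℕ) : ∀ n : ℤ, 0 ≤ n → n < impulse a (N + 2) →
    ∃ ε : ℕ → ℕ, Admissible a ε ∧ (∀ i, N ≤ i → ε i = 0) ∧
      ∑ i ∈ Finset.range N, (ε i : ℤ) * impulse a (i + 2) = n := by
  induction N with
  | zero =>
    intro n h0 h1
    refine ⟨fun _ => 0, Admissible.of_sum_lt fun k => ?_, fun _ _ => rfl, ?_⟩
    · simpa using impulse_pos ha k
    · simp [impulse] at h1
      simp; omega
  | succ N ih =>
    intro n h0 h1
    have hp := impulse_pos ha N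
    obtain ⟨ε, hε, hz, hs⟩ := ih (n % impulse a (N + 2)) (Int.emod_nonneg _ hp.ne')
      (Int.emod_lt_of_pos _ hp)
    have hd : ((n / impulse a (N + 2)).toNat : ℤ) = n / impulse a (N + 2) :=
      Int.toNat_of_nonneg (Int.ediv_nonneg h0 hp.le)
    set ε' := Function.update ε N (n / impulse a (N + 2)).toNat with hε'
    have hlow : ∀ k ≤ N, ∑ i ∈ Finset.range k, (ε' i : ℤ) * impulse a (i + 2) =
        ∑ i ∈ Finset.range k, (ε i : ℤ) * impulse a (i + 2) := fun k hk =>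
      Finset.sum_congr rfl fun i hi => by
        have : i ≠ N := by have := Finset.mem_range.1 hi; omega
        simp [hε', this]
    have hzero : ∀ i, N + 1 ≤ i → ε' i = 0 := fun i hi => by
      have : i ≠ N := by omega
      simp [hε', this, hz i (by omega)]
    have hsum : ∑ i ∈ Finset.range (N + 1), (ε' i : ℤ) * impulse a (i + 2) = n := by
      rw [Finset.sum_range_succ, hlow N le_rfl, hs, hε', Function.update_self, hd, mul_comm]
      exact Int.emod_add_mul_ediv _ _
    refine ⟨ε', Admissible.of_sum_lt fun k => ?_, hzero, hsum⟩
    rcases Nat.lt_or_ge N k with hk | hk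
    · rw [← Finset.sum_subset (Finset.range_mono (show N + 1 ≤ k from hk)) fun i _ hi => by
        simp [hzero i (by simpa using hi)], hsum]
      exact h1.trans_le (impulse_mono ha (by omega))
    · rw [hlow k hk]
      exact hε.sum_lt k

theorem hasSum_of_finite {ε : ℕ → ℕ} {N : ℕ} (hz : ∀ i, N ≤ i → ε i = 0) :
    HasSum (fun i : ℕ => (ε i : ℂ) * α ^ (i + 2)) (∑ i ∈ Finset.range N, (ε i : ℂ) * α ^ (i + 2)) :=
  hasSum_sum_of_ne_finset_zero fun i hi => by simp [hz i (by simpa using hi)]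

theorem exists_fractal_add_lattice (ha : 2 ≤ a) (hroot : α ^ 3 - (a : ℂ) * α ^ 2 + α - 1 = 0)
    {u : ℂ} (hu : u ∈ lattice α) {r : ℤ} (hr : 0 ≤ r) :
    u + r * α ^ 2 ∈ fractal a α + lattice α := by
  have hlt : r < impulse a (r.toNat + 1 + 2) := by
    have := le_impulse ha (r.toNat + 1 + 1)
    push_cast at this
    rw [Int.toNat_of_nonneg hr] at this
    rw [show r.toNat + 1 + 2 = r.toNat + 1 + 1 + 1 by ring]
    linarith
  obtain ⟨ε, hε, hz, hs⟩ := exists_greedy ha _ r hr hlt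
  refine ⟨_, ⟨ε, hε, hasSum_of_finite hz⟩, _, sub_mem_lattice hu (sum_mem_lattice
    (Finset.range (r.toNat + 1)) fun i _ => intCast_mul_mem_lattice (ε i)
      (pow_sub_impulse_mem hroot (i + 2))), ?_⟩
  have hs' : (r : ℂ) = ∑ i ∈ Finset.range (r.toNat + 1), (ε i : ℂ) * impulse a (i + 2) := by
    exact_mod_cast congrArg (Int.cast : ℤ → ℂ) hs.symm
  simp only [mul_sub, Finset.sum_sub_distrib, Int.cast_natCast, ← mul_assoc, ← Finset.sum_mul,
    ← hs']
  ring

/-- Points α^n(p + qα) approximate z, but their α² coefficient may be negative. Adding a small α^m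
with large `impulse a m` repairs the sign. -/
theorem dense_fractal_add_lattice (ha : 2 ≤ a) (hroot : α ^ 3 - (a : ℂ) * α ^ 2 + α - 1 = 0)
    (hnonreal : α.im ≠ 0) : Dense (fractal a α + lattice α) := by
  have hα := norm_lt_one ha hroot hnonreal
  have hα0 : α ≠ 0 := by rintro rfl; simp at hnonreal
  have hlim := tendsto_pow_atTop_nhds_zero_of_lt_one (norm_nonneg α) hα
  refine Metric.dense_iff.2 fun z r hr => ?_
  obtain ⟨n, hn⟩ := ((hlim.mul_const (1 + ‖α‖)).eventually_lt_const
    (show 0 * (1 + ‖α‖) < r / 2 by rw [zero_mul]; positivity)).exists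
  obtain ⟨p, q, hpq⟩ := exists_lattice_near hnonreal (z / α ^ n)
  have hm1 : ∀ᶠ m : ℕ in atTop, 0 ≤ p * impulse a n + q * impulse a (n + 1) + impulse a m := by
    refine eventually_atTop.2 ⟨(-(p * impulse a n + q * impulse a (n + 1))).toNat + 1,
      fun m hm => ?_⟩
    have h1 := le_impulse ha (m - 1)
    rw [Nat.sub_add_cancel (by omega)] at h1
    omega
  obtain ⟨m, hm, hm'⟩ := (hm1.and (hlim.eventually_lt_const (half_pos hr))).exists
  have h0 := pow_sub_impulse_mem hroot n
  have h1 := pow_sub_impulse_mem hroot (n + 1)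
  have h2 := pow_sub_impulse_mem hroot m
  refine ⟨α ^ n * (p + q * α) + α ^ m, ?_, ?_⟩
  · rw [Metric.mem_ball, dist_comm, dist_eq_norm]
    have e : z - (α ^ n * (p + q * α) + α ^ m) = α ^ n * (z / α ^ n - (p + q * α)) - α ^ m := by
      field_simp
      ring
    rw [e]
    refine (norm_sub_le _ _).trans_lt ?_
    rw [norm_mul, norm_pow, norm_pow]
    have := mul_le_mul_of_nonneg_left hpq (pow_nonneg (norm_nonneg α) n)
    linarith
  · convert exists_fractal_add_lattice ha hroot (add_mem_lattice (add_mem_lattice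
      (intCast_mul_mem_lattice p h0) (intCast_mul_mem_lattice q h1)) h2) hm using 1
    push_cast
    ring

theorem summable_digits (hα : ‖α‖ < 1) {ε : ℕ → ℕ} (h : ∀ i, ε i < a) :
    Summable (fun i : ℕ => (ε i : ℂ) * α ^ (i + 2)) := by
  refine Summable.of_norm_bounded
    ((summable_geometric_of_lt_one (norm_nonneg α) hα).mul_left (a : ℝ)) fun i => ?_
  rw [norm_mul, norm_pow, Complex.norm_natCast]
  have h1 : (ε i : ℝ) ≤ a := by exact_mod_cast (h i).le
  have h2 : ‖α‖ ^ (i + 2) ≤ ‖α‖ ^ i := pow_le_pow_of_le_one (norm_nonneg α) hα.le (by omega)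
  exact mul_le_mul h1 h2 (by positivity) (by positivity)

theorem isCompact_admissible (ha : 2 ≤ a) : IsCompact {ε : ℕ → ℕ | Admissible a ε} := by
  refine (isCompact_univ_pi fun _ : ℕ => (Set.finite_lt_nat a).isCompact).of_isClosed_subset ?_
    fun ε hε i _ => hε.digit_lt ha i
  have : {ε : ℕ → ℕ | Admissible a ε} = ⋂ N, ⋂ j, ⋂ _ : j ≤ N, {ε : ℕ → ℕ |
      ∑ i ∈ Finset.range (j + 1), (ε i : ℤ) * gSeq a i < gSeq a (j + 1)} := by
    ext ε
    simp [Admissible, IsGreedy]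
  rw [this]
  refine isClosed_iInter fun N => isClosed_iInter fun j => isClosed_iInter fun _ => ?_
  have hc : Continuous fun ε : ℕ → ℕ => ∑ i ∈ Finset.range (j + 1), (ε i : ℤ) * gSeq a i :=
    continuous_finsetSum _ fun i _ =>
      ((continuous_of_discreteTopology (f := fun n : ℕ => (n : ℤ))).comp
        (continuous_apply i)).mul continuous_const
  exact (isClosed_discrete (Set.Iio (gSeq a (j + 1)))).preimage hc

theorem isCompact_fractal (ha : 2 ≤ a) (hα : ‖α‖ < 1) : IsCompact (fractal a α) := by
  have h : fractal a α = (fun ε : ℕ → ℕ => ∑' i : ℕ, (ε i : ℂ) * α ^ (i + 2)) ''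
      {ε : ℕ → ℕ | Admissible a ε} := by
    ext z
    constructor
    · rintro ⟨ε, hε, hz⟩
      exact ⟨ε, hε, hz.tsum_eq⟩
    · rintro ⟨ε, hε, rfl⟩
      exact ⟨ε, hε, (summable_digits hα (hε.digit_lt ha)).hasSum⟩
  rw [h]
  refine (isCompact_admissible ha).image_of_continuousOn (continuousOn_tsum
    (fun i => Continuous.continuousOn ?_)
    ((summable_geometric_of_lt_one (norm_nonneg α) hα).mul_left (a : ℝ)) fun i ε hε => ?_)
  · exact ((continuous_of_discreteTopology (f := fun n : ℕ => (n : ℂ))).comp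
      (continuous_apply i)).mul continuous_const
  · rw [norm_mul, norm_pow, Complex.norm_natCast]
    have h1 : (ε i : ℝ) ≤ a := by exact_mod_cast (Admissible.digit_lt ha hε i).le
    have h2 : ‖α‖ ^ (i + 2) ≤ ‖α‖ ^ i := pow_le_pow_of_le_one (norm_nonneg α) hα.le (by omega)
    exact mul_le_mul h1 h2 (by positivity) (by positivity)

theorem mem_tile {u z : ℂ} : z ∈ tile a α u ↔ z - u ∈ fractal a α := by
  constructor
  · rintro ⟨t, ht, rfl⟩
    simpa using ht
  · exact fun h => ⟨_, h, by simp⟩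

theorem iUnion_tile_eq_add (S : Set ℂ) : ⋃ u ∈ S, tile a α u = fractal a α + S := by
  ext z
  simp only [Set.mem_iUnion, mem_tile, Set.mem_add]
  constructor
  · rintro ⟨u, hu, h⟩
    exact ⟨_, h, u, hu, by ring⟩
  · rintro ⟨t, ht, u, hu, rfl⟩
    exact ⟨u, hu, by simpa using ht⟩

theorem isClosed_iUnion_tile (ha : 2 ≤ a) (hroot : α ^ 3 - (a : ℂ) * α ^ 2 + α - 1 = 0)
    (hnonreal : α.im ≠ 0) {S : Set ℂ} (hS : S ⊆ lattice α) :
    IsClosed (⋃ u ∈ S, tile a α u) := by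
  rw [iUnion_tile_eq_add]
  exact (isClosed_of_subset_lattice hnonreal hS).add_left_of_isCompact
    (isCompact_fractal ha (norm_lt_one ha hroot hnonreal))

theorem iUnion_tile_eq_univ (ha : 2 ≤ a) (hroot : α ^ 3 - (a : ℂ) * α ^ 2 + α - 1 = 0)
    (hnonreal : α.im ≠ 0) : ⋃ u ∈ lattice α, tile a α u = Set.univ := by
  have hc := isClosed_iUnion_tile ha hroot hnonreal (subset_refl (lattice α))
  have hd := dense_fractal_add_lattice ha hroot hnonreal
  rw [← iUnion_tile_eq_add] at hd
  rw [← hc.closure_eq, hd.closure_eq]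

end Covering

end GRauzy

/-! ### Disjointness, neighbors and boundary. -/

namespace GRauzy
open Filter Topology Pointwise

section Tiling

variable {a : ℕ} {α : ℂ}

theorem Admissible.truncate (ha : 2 ≤ a) {ε : ℕ → ℕ} (h : Admissible a ε) (N : ℕ) :
    Admissible a (fun i => if i < N then ε i else 0) := by
  refine Admissible.of_sum_lt fun k => (Finset.sum_le_sum fun i _ => ?_).trans_lt (h.sum_lt k)
  refine mul_le_mul_of_nonneg_right ?_ (impulse_nonneg ha _)
  split_ifs <;> simp

/-- Truncated expansions in the second tile approach the common point, so one of them lies in the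
first tile, where a finite string forces zero carries. -/
theorem eq_of_interior_inter (ha : 2 ≤ a) (hroot : α ^ 3 - (a : ℂ) * α ^ 2 + α - 1 = 0)
    (hnonreal : α.im ≠ 0) {u v : ℂ} (hu : u ∈ lattice α) (hv : v ∈ lattice α)
    (h : (interior (tile a α u) ∩ tile a α v).Nonempty) : u = v := by
  obtain ⟨z, hzu, hzv⟩ := h
  obtain ⟨ε', hε', hs'⟩ := mem_tile.1 hzv
  have hlim := hs'.tendsto_sum_nat.add_const v
  rw [sub_add_cancel] at hlim
  obtain ⟨N, hN⟩ := (hlim.eventually (isOpen_interior.mem_nhds hzu)).exists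
  obtain ⟨ε, hε, hs⟩ := mem_tile.1 (interior_subset hN)
  obtain ⟨p, q, hpq⟩ := sub_mem_lattice hv hu
  have hfin : HasSum (fun i : ℕ => ((if i < N then ε' i else 0 : ℕ) : ℂ) * α ^ (i + 2))
      (∑ i ∈ Finset.range N, (ε' i : ℂ) * α ^ (i + 2)) := by
    convert hasSum_of_finite (α := α) (ε := fun i => if i < N then ε' i else 0) (N := N)
      (fun i hi => by simp [hi]) using 1
    exact Finset.sum_congr rfl fun i hi => by simp [Finset.mem_range.1 hi]
  have hW := carry_eq_zero_of_finite ha hroot hnonreal hε (Admissible.truncate ha hε' N) hs hfin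
    (isCarry_carry a p q _) (by
      rw [show carry a p q _ 1 = p from rfl, show carry a p q _ 2 = p + q from rfl]
      push_cast
      linear_combination hpq) (m := N) (fun i hi => by simp [hi])
  have h1 : p = 0 := hW 1
  have h2 : p + q = 0 := hW 2
  have h3 : q = 0 := by omega
  rw [h1, h3] at hpq
  simp at hpq
  exact (sub_eq_zero.1 hpq).symm

/-- A bounded carry sequence makes the signed digits sum up to the period. -/
theorem tendsto_of_bounded_carry (hroot : α ^ 3 - (a : ℂ) * α ^ 2 + α - 1 = 0) (hα : ‖α‖ < 1)
    {d W : ℕ → ℤ} (hW : IsCarry a d W) (hb : ∀ k, |W k| ≤ 1) :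
    Tendsto (fun k => ∑ i ∈ Finset.range k, (d i : ℂ) * α ^ (i + 2)) atTop
      (𝓝 (W 1 * (1 - α) + W 2 * α)) := by
  have h : ∀ k, ∑ i ∈ Finset.range k, (d i : ℂ) * α ^ (i + 2) = W 1 * (1 - α) + W 2 * α -
      α ^ k * (W k * α ^ 2 + W (k + 1) * (1 - α) + W (k + 2) * α) := fun k => by
    have := hW.sum_add (isRec_pow a hroot) k
    simp only [pow_zero, pow_one] at this
    rw [← this]
    ring
  simp_rw [h]
  have hb' : ∀ k, ‖(W k : ℂ)‖ ≤ 1 := fun k => by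
    rw [Complex.norm_intCast]
    exact_mod_cast hb k
  have hz : Tendsto (fun k => α ^ k * (W k * α ^ 2 + W (k + 1) * (1 - α) + W (k + 2) * α)) atTop
      (𝓝 0) := by
    refine (tendsto_pow_atTop_nhds_zero_of_norm_lt_one hα).zero_mul_isBoundedUnder_le
      ⟨‖α ^ 2‖ + ‖1 - α‖ + ‖α‖, eventually_map.2 (Eventually.of_forall fun k => ?_)⟩
    refine (norm_add₃_le).trans ?_
    simp only [norm_mul]
    gcongr
    · exact mul_le_of_le_one_left (norm_nonneg _) (hb' _)
    · exact mul_le_of_le_one_left (norm_nonneg _) (hb' _)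
    · exact mul_le_of_le_one_left (norm_nonneg _) (hb' _)
  simpa using hz.const_sub (W 1 * (1 - α) + W 2 * α : ℂ)

theorem inter_nonempty_of_carry (ha : 2 ≤ a) (hroot : α ^ 3 - (a : ℂ) * α ^ 2 + α - 1 = 0)
    (hα : ‖α‖ < 1) {ε ε' : ℕ → ℕ} (hε : Admissible a ε) (hε' : Admissible a ε') {W : ℕ → ℤ}
    (hW : IsCarry a (fun i => (ε i : ℤ) - ε' i) W) (hb : ∀ k, |W k| ≤ 1) :
    (fractal a α ∩ tile a α (W 1 * (1 - α) + W 2 * α)).Nonempty := by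
  have hs := (summable_digits hα (hε.digit_lt ha)).hasSum
  have hs' := (summable_digits hα (hε'.digit_lt ha)).hasSum
  refine ⟨_, ⟨ε, hε, hs⟩, mem_tile.2 ⟨ε', hε', ?_⟩⟩
  convert hs' using 1
  have h := (hs.sub hs').tendsto_sum_nat
  have h' := tendsto_of_bounded_carry hroot hα hW hb
  have := tendsto_nhds_unique h' (by simpa only [Int.cast_sub, Int.cast_natCast, sub_mul] using h)
  rw [this]
  ring

/-- The `4`-periodic sequence `0, 1, 0, -1, …`. -/
def wave (k : ℕ) : ℤ := if k % 4 = 1 then 1 else if k % 4 = 3 then -1 else 0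

theorem wave_abs_le (k : ℕ) : |wave k| ≤ 1 := by
  unfold wave
  split_ifs <;> simp

/-- Since wave n + wave (n+2) = 0, the required digit difference is (1 − a) wave (n+1), so the
digits a − 1 are never adjacent. -/
theorem inter_one_sub_nonempty (ha : 2 ≤ a) (hroot : α ^ 3 - (a : ℂ) * α ^ 2 + α - 1 = 0)
    (hα : ‖α‖ < 1) : (fractal a α ∩ tile a α (1 - α)).Nonempty := by
  have h := inter_nonempty_of_carry ha hroot hα (W := wave)
    (ε := fun i => if i % 4 = 2 then a - 1 else 0) (ε' := fun i => if i % 4 = 0 then a - 1 else 0)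
    (admissible_of_no_adjacent_max ha (fun k => by grind) (fun k => by grind))
    (admissible_of_no_adjacent_max ha (fun k => by grind) (fun k => by grind))
    ⟨rfl, fun n => by unfold wave; grind⟩ wave_abs_le
  simpa [wave] using h

theorem inter_root_nonempty (ha : 2 ≤ a) (hroot : α ^ 3 - (a : ℂ) * α ^ 2 + α - 1 = 0)
    (hα : ‖α‖ < 1) : (fractal a α ∩ tile a α α).Nonempty := by
  have h := inter_nonempty_of_carry ha hroot hα
    (W := fun k => if k = 0 then 0 else wave (k - 1))
    (ε := fun i => if i = 0 then 1 else if i % 4 = 3 then a - 1 else 0)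
    (ε' := fun i => if i % 4 = 1 then a - 1 else 0)
    (admissible_of_no_adjacent_max ha (fun k => by grind) (fun k => by grind))
    (admissible_of_no_adjacent_max ha (fun k => by grind) (fun k => by grind))
    ⟨rfl, fun n => by unfold wave; grind⟩ (fun k => by
      split_ifs
      · simp
      · exact wave_abs_le _)
  simpa [wave] using h

/-- The carries start 0, 1, 1 and then follow the delayed wave; the recurrence dictates the
exceptional digits a − 1, a − 2. -/
theorem inter_one_nonempty (ha : 2 ≤ a) (hroot : α ^ 3 - (a : ℂ) * α ^ 2 + α - 1 = 0)
    (hα : ‖α‖ < 1) : (fractal a α ∩ tile a α 1).Nonempty := by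
  have h := inter_nonempty_of_carry ha hroot hα
    (W := fun k => if k = 0 then 0 else if k = 1 then 1 else wave (k - 1))
    (ε := fun i => if i % 4 = 3 then a - 1 else 0)
    (ε' := fun i => if i = 0 then a - 1 else if i = 1 then a - 2 else
      if i % 4 = 1 then a - 1 else 0)
    (admissible_of_no_adjacent_max ha (fun k => by grind) (fun k => by grind))
    (admissible_of_no_adjacent_max ha (fun k => by grind) (fun k => by grind))
    ⟨rfl, fun n => by unfold wave; grind⟩ (fun k => by
      split_ifs
      · simp
      · simp
      · exact wave_abs_le _)
  simpa [wave] using h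

theorem inter_neg_nonempty {u : ℂ} (h : (fractal a α ∩ tile a α u).Nonempty) :
    (fractal a α ∩ tile a α (-u)).Nonempty := by
  obtain ⟨z, hz, hzu⟩ := h
  exact ⟨z - u, mem_tile.1 hzu, mem_tile.2 (by simpa using hz)⟩

theorem sixTranslations_subset_lattice : sixTranslations α ⊆ lattice α := by
  rintro u (rfl | rfl | rfl | rfl | rfl | rfl)
  · exact ⟨1, 0, by simp⟩
  · exact ⟨-1, 0, by simp⟩
  · exact ⟨0, 1, by simp⟩
  · exact ⟨0, -1, by simp⟩
  · exact ⟨-1, 1, by push_cast; ring⟩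
  · exact ⟨1, -1, by push_cast; ring⟩

theorem ne_zero_of_mem_sixTranslations (hnonreal : α.im ≠ 0) {u : ℂ}
    (hu : u ∈ sixTranslations α) : u ≠ 0 := by
  rintro rfl
  rcases hu with h | h | h | h | h | h <;>
    · have h1 := congrArg Complex.re h
      have h2 := congrArg Complex.im h
      simp at h1 h2
      try exact hnonreal (by linarith)

theorem neighbors_eq (ha : 2 ≤ a) (hroot : α ^ 3 - (a : ℂ) * α ^ 2 + α - 1 = 0)
    (hnonreal : α.im ≠ 0) : neighbors a α = sixTranslations α := by
  have hα := norm_lt_one ha hroot hnonreal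
  ext u
  constructor
  · rintro ⟨⟨p, q, rfl⟩, hne, z, ⟨ε, hε, hs⟩, hzu⟩
    obtain ⟨ε', hε', hs'⟩ := mem_tile.1 hzu
    exact (Set.mem_insert_iff.1 (tile_meets ha hroot hnonreal hε hε' hs hs'
      (sub_sub_cancel z _))).resolve_left hne
  · intro hu
    refine ⟨sixTranslations_subset_lattice hu, ne_zero_of_mem_sixTranslations hnonreal hu, ?_⟩
    have h1 := inter_one_sub_nonempty ha hroot hα
    have h2 := inter_neg_nonempty h1
    rw [neg_sub] at h2
    rcases hu with rfl | rfl | rfl | rfl | rfl | rfl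
    · exact inter_one_nonempty ha hroot hα
    · exact inter_neg_nonempty (inter_one_nonempty ha hroot hα)
    · exact inter_root_nonempty ha hroot hα
    · exact inter_neg_nonempty (inter_root_nonempty ha hroot hα)
    · exact h2
    · rwa [neg_sub]

theorem ncard_sixTranslations (hnonreal : α.im ≠ 0) : (sixTranslations α).ncard = 6 := by
  have key : ∀ p q r s : ℝ, (p : ℂ) + q * α = r + s * α → p = r ∧ q = s := fun p q r s h => by
    have := congrArg (coords α) h
    rw [coords_add_mul hnonreal, coords_add_mul hnonreal] at this
    exact Prod.ext_iff.1 this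
  have h : sixTranslations α = (fun x : ℤ × ℤ => (x.1 : ℂ) + x.2 * α) ''
      (({(1, 0), (-1, 0), (0, 1), (0, -1), (-1, 1), (1, -1)} : Finset (ℤ × ℤ)) : Set (ℤ × ℤ)) := by
    simp only [sixTranslations, Finset.coe_insert, Finset.coe_singleton, Set.image_insert_eq,
      Set.image_singleton]
    congr! 1
    · simp
    congr! 1
    · simp
    congr! 1
    · simp
    congr! 1
    · simp
    congr! 1
    · push_cast; ring
    · push_cast; ring_nf
  rw [h, Set.ncard_image_of_injective, Set.ncard_coe_finset]
  · decide
  · rintro ⟨p, q⟩ ⟨r, s⟩ hx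
    have := key p q r s (by simpa using hx)
    ext
    · exact_mod_cast this.1
    · exact_mod_cast this.2

theorem frontier_fractal (ha : 2 ≤ a) (hroot : α ^ 3 - (a : ℂ) * α ^ 2 + α - 1 = 0)
    (hnonreal : α.im ≠ 0) : frontier (fractal a α) =
      ⋃ u ∈ sixTranslations α, fractal a α ∩ tile a α u := by
  have hcl : IsClosed (fractal a α) :=
    (isCompact_fractal ha (norm_lt_one ha hroot hnonreal)).isClosed
  have h0 : tile a α 0 = fractal a α := by ext; simp [mem_tile]
  rw [hcl.frontier_eq]
  ext z
  simp only [Set.mem_sdiff, Set.mem_iUnion, Set.mem_inter_iff]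
  constructor
  · rintro ⟨hz, hzi⟩
    by_contra hcon
    push Not at hcon
    -- The complement of all other tiles is open and, by the covering, contained in the fractal.
    have hS : lattice α \ {0} ⊆ lattice α := Set.sdiff_subset
    refine hzi (mem_interior.2 ⟨(⋃ u ∈ lattice α \ {0}, tile a α u)ᶜ, fun x hx => ?_,
      (isClosed_iUnion_tile ha hroot hnonreal hS).isOpen_compl, ?_⟩)
    · have hx' : x ∈ ⋃ u ∈ lattice α, tile a α u := by
        rw [iUnion_tile_eq_univ ha hroot hnonreal]; trivial
      simp only [Set.mem_iUnion, Set.mem_compl_iff] at hx hx'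
      obtain ⟨u, hu, hxu⟩ := hx'
      by_cases hu0 : u = 0
      · rwa [hu0, h0] at hxu
      · exact (hx ⟨u, ⟨hu, hu0⟩, hxu⟩).elim
    · simp only [Set.mem_iUnion, Set.mem_compl_iff]
      rintro ⟨u, ⟨hu, hu0⟩, hzu⟩
      have hn : u ∈ neighbors a α := ⟨hu, hu0, z, hz, hzu⟩
      rw [neighbors_eq ha hroot hnonreal] at hn
      exact hcon u hn hz hzu
  · rintro ⟨u, hu, hz, hzu⟩
    refine ⟨hz, fun hzi => ne_zero_of_mem_sixTranslations hnonreal hu ?_⟩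
    exact (eq_of_interior_inter ha hroot hnonreal zero_mem_lattice
      (sixTranslations_subset_lattice hu) ⟨z, by rwa [h0], hzu⟩).symm

end Tiling

end GRauzy

theorem theorem4p4 (a : ℕ) (ha : 2 ≤ a) (α : ℂ)
    (hroot : α ^ 3 - (a : ℂ) * α ^ 2 + α - 1 = 0) (hnonreal : α.im ≠ 0) :
    ((⋃ u ∈ GRauzy.lattice α, GRauzy.tile a α u) = Set.univ ∧
      ∀ u ∈ GRauzy.lattice α, ∀ v ∈ GRauzy.lattice α,
        (interior (GRauzy.tile a α u) ∩ GRauzy.tile a α v).Nonempty → u = v) ∧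
    frontier (GRauzy.fractal a α) =
      (⋃ u ∈ GRauzy.sixTranslations α, GRauzy.fractal a α ∩ GRauzy.tile a α u) ∧
    GRauzy.neighbors a α = GRauzy.sixTranslations α ∧
    (GRauzy.neighbors a α).ncard = 6 :=
  ⟨⟨GRauzy.iUnion_tile_eq_univ ha hroot hnonreal,
      fun _ hu _ hv h => GRauzy.eq_of_interior_inter ha hroot hnonreal hu hv h⟩,
    GRauzy.frontier_fractal ha hroot hnonreal, GRauzy.neighbors_eq ha hroot hnonreal, by
      rw [GRauzy.neighbors_eq ha hroot hnonreal, GRauzy.ncard_sixTranslations hnonreal]⟩
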